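/- **Setting.** Let $p,q\ge 2$, let Greek indices run over $1,\dots,p$ and Latin indices over $1,\dots,q$ (with summation over repeated indices), and let $M$ be a smooth manifold of dimension $pq$ with an almost Grassmann structure $AG(p-1,p+q-1)$, i.e. a smooth field of Segre cones $SC_x(p,q)\subset T_xM$, given in adapted local coframes $\omega_\alpha^i$ by $\omega_\alpha^i(z)=t_\alpha s^i$. A *reduced (fourth-order) moving frame* over a coordinate domain of $M$ consists of smooth 1-forms $\omega_\alpha^i,\ \omega_\alpha^\beta,\ \omega_j^i,\ \omega,\ \omega_i^\alpha$ on it, where $(\omega_\alpha^i)$ is an adapted coframe and $\omega_\gamma^\gamma=0$, $\omega_k^k=0$, $d\omega=\omega_i^\alpha\wedge\omega_\alpha^i$. The functions $a,b,c$ are defined as the coefficients, skew-symmetric in the two vertical pairs of indices $\binom{\beta}{j},\binom{\gamma}{k}$ (resp. $\binom{\gamma}{k},\binom{\delta}{l}$), in the structure equations $$\begin{aligned} d\omega_\alpha^i-\omega_\alpha^j\wedge\omega_j^i-\omega_\alpha^\beta\wedge\omega_\beta^i-\omega\wedge\omega_\alpha^i&=a^{i\beta\gamma}_{\alpha jk}\,\omega_\beta^j\wedge\omega_\gamma^k,\\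 d\omega_\alpha^\beta-\omega_\alpha^\gamma\wedge\omega_\gamma^\beta-\tfrac{q}{p+q}\bigl(\delta_\alpha^\beta\,\omega_\gamma^k\wedge\omega_k^\gamma-p\,\omega_\alpha^k\wedge\omega_k^\beta\bigr)&=b^{\beta\gamma\delta}_{\alpha kl}\,\omega_\gamma^k\wedge\omega_\delta^l,\\ d\omega_j^i-\omega_j^k\wedge\omega_k^i-\tfrac{p}{p+q}\bigl(\delta_j^i\,\omega_k^\gamma\wedge\omega_\gamma^k-q\,\omega_j^\gamma\wedge\omega_\gamma^i\bigr)&=b^{i\gamma\delta}_{jkl}\,\omega_\gamma^k\wedge\omega_\delta^l,\\ d\omega_i^\alpha-\omega_i^\beta\wedge\omega_\beta^\alpha-\omega_i^j\wedge\omega_j^\alpha+\omega\wedge\omega_i^\alpha+a^{k\alpha\beta}_{\gamma ij}\,\omega_k^\gamma\wedge\omega_\beta^j&=c^{\alpha\beta\gamma}_{ijk}\,\omega_\gamma^k\wedge\omega_\beta^j , \end{aligned}$$ and the frame is reduced by the normalizations $a^{i\alpha\gamma}_{\alpha jk}=0$, $a^{i\beta\gamma}_{\alpha ik}=0$ and $b^{\gamma\alpha\delta}_{\alpha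 kl}-b^{i\gamma\delta}_{kil}+b^{\delta\alpha\gamma}_{\alpha lk}-b^{i\delta\gamma}_{lik}=0$. Write $b^1=\{b^{i\gamma\delta}_{jkl}\}$, $b^2=\{b^{\beta\gamma\delta}_{\alpha kl}\}$. The Pfaffian derivatives of $a$, $b^2$ and $b^1$ are the coefficients with respect to the basis forms $\omega_\varepsilon^m$ of the 1-forms $$\nabla a^{i\beta\gamma}_{\alpha jk}+a^{i\beta\gamma}_{\alpha jk}\,\omega,$$ $$\nabla b^{\beta\gamma\delta}_{\alpha kl}+2b^{\beta\gamma\delta}_{\alpha kl}\,\omega-\tfrac{pq}{2(p+q)}\bigl(2\delta_\varepsilon^\beta a^{m\gamma\delta}_{\alpha kl}-\delta_\alpha^\gamma a^{m\beta\delta}_{\varepsilon kl}+\delta_\alpha^\delta a^{m\beta\gamma}_{\varepsilon lk}\bigr)\omega_m^\varepsilon,$$ $$\nabla b^{i\gamma\delta}_{jkl}+2b^{i\gamma\delta}_{jkl}\,\omega+\tfrac{pq}{2(p+q)}\bigl(2\delta_j^m a^{i\gamma\delta}_{\varepsilon kl}-\delta_k^i a^{m\gamma\delta}_{\varepsilon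 jl}+\delta_l^i a^{m\delta\gamma}_{\varepsilon jk}\bigr)\omega_m^\varepsilon,$$ where $\nabla$ is the covariant differential: it is $d$ plus one term for each index, namely $-T_{\varepsilon}\,\omega_\alpha^\varepsilon$ for a lower index $\alpha$, $-T_l\,\omega_j^l$ for a lower index $j$, $+T^{\varepsilon}\,\omega_\varepsilon^\beta$ for an upper index $\beta$, $+T^l\,\omega_l^i$ for an upper index $i$. **Theorem.** If $p>2$, the components of $c$ are expressed in terms of the components of $(a,b^2)$ and their Pfaffian derivatives; if $q>2$, the components of $c$ are expressed in terms of the components of $(a,b^1)$ and their Pfaffian derivatives. Here "expressed" means: there are polynomials with rational coefficients, depending only on $p$ and $q$, which at every point of every reduced moving frame of every almost Grassmann structure $AG(p-1,p+q-1)$ give $c^{\alpha\beta\gamma}_{ijk}$ as a polynomial in the components of $a$ and $b^2$ (resp. $b^1$) and their first Pfaffian derivatives. -/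

import Mathlib

open scoped Manifold ContDiff

universe u

noncomputable section

namespace AlmostGrassmann

/-! Greek indices range over `Fin p`, Latin indices over `Fin q`; manifolds have dimension `p * q`.
The components of an object are written with the upper indices first, then the lower ones:
`a i β γ α j k` is `a^{iβγ}_{αjk}`. -/

/-- The coordinate space of dimension `pq`. -/
abbrev Model (p q : ℕ) : Type := EuclideanSpace ℝ (Fin (p * q))

/-- Differential 1-forms on (open subsets of) the coordinate space. -/
abbrev OneForm (p q : ℕ) : Type := Model p q → (Model p q →L[ℝ] ℝ)

/-- Kronecker delta. -/
def kron {n : ℕ} (a b : Fin n) : ℝ := if a = b then 1 else 0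

/-- The exterior product of two covectors, as a function of two vectors. -/
def wedge {p q : ℕ} (μ ν : Model p q →L[ℝ] ℝ) (u v : Model p q) : ℝ := μ u * ν v - μ v * ν u

/-- The exterior differential of a 1-form at `x`, as a function of two vectors. -/
def extD {p q : ℕ} (μ : OneForm p q) (x u v : Model p q) : ℝ :=
  extDeriv (fun z => ContinuousAlternatingMap.ofSubsingleton ℝ (Model p q) ℝ (0 : Fin 1) (μ z))
    x ![u, v]

section Structures

variable {M : Type*} [TopologicalSpace M]

/-- `θ = (θ_α^i)` is, on the domain of the chart `e` and in the coordinates of `e`, a smooth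
coframe in which the cone field is given by `z_α^i = t_α s^i`. -/
def IsAdaptedCoframe {p q : ℕ} [ChartedSpace (Model p q) M]
    (cone : ∀ x : M, Set (TangentSpace 𝓘(ℝ, Model p q) x))
    (e : OpenPartialHomeomorph M (Model p q)) (θ : Fin p → Fin q → OneForm p q) : Prop :=
  (∀ α i, ContDiffOn ℝ ∞ (θ α i) e.target) ∧
  ∀ y ∈ e.target,
    LinearIndependent ℝ (fun s : Fin p × Fin q => θ s.1 s.2 y) ∧
    ∀ v : Model p q,
      mfderiv 𝓘(ℝ, Model p q) 𝓘(ℝ, Model p q) e.symm y v ∈ cone (e.symm y) ↔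
        ∃ (t : Fin p → ℝ) (s : Fin q → ℝ), ∀ α i, θ α i y v = t α * s i

/-- An almost Grassmann structure `AG(p-1, p+q-1)` on a manifold `M` of dimension `pq`:
a smooth field of Segre cones `SC_x(p, q)` in the tangent spaces of `M`. -/
structure AlmostGrassmannStructure (p q : ℕ) (M : Type*) [TopologicalSpace M]
    [ChartedSpace (Model p q) M] where
  /-- the Segre cone at each point -/
  cone : ∀ x : M, Set (TangentSpace 𝓘(ℝ, Model p q) x)
  /-- smoothness of the field of cones -/
  locally_segre : ∀ x : M, ∃ e ∈ IsManifold.maximalAtlas 𝓘(ℝ, Model p q) ∞ M,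
    x ∈ e.source ∧ ∃ θ : Fin p → Fin q → OneForm p q, IsAdaptedCoframe cone e θ

end Structures

/-- The frame vectors `e_i^α` and the forms `ω_α^i, ω_α^β, ω_j^i, ω, ω_i^α` along a moving frame,
in the coordinates of a chart. The lower index is the first argument of a form. -/
structure MovingFrame (p q : ℕ) where
  /-- the vector fields `e_i^α` -/
  vec : Fin q → Fin p → Model p q → Model p q
  /-- the basis forms `ω_α^i` -/
  cof : Fin p → Fin q → OneForm p q
  /-- the forms `ω_α^β` -/
  gr : Fin p → Fin p → OneForm p q
  /-- the forms `ω_j^i` -/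
  la : Fin q → Fin q → OneForm p q
  /-- the form `ω` -/
  sc : OneForm p q
  /-- the forms `ω_i^α` -/
  pr : Fin q → Fin p → OneForm p q

namespace MovingFrame

variable {p q : ℕ} (F : MovingFrame p q)

/-- The torsion form
`dω_α^i - ω_α^j ∧ ω_j^i - ω_α^β ∧ ω_β^i - ω ∧ ω_α^i = a^{iβγ}_{αjk} ω_β^j ∧ ω_γ^k`. -/
def torsionForm (α : Fin p) (i : Fin q) (x u v : Model p q) : ℝ :=
  extD (F.cof α i) x u v
    - ∑ j, wedge (F.cof α j x) (F.la j i x) u v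
    - ∑ β, wedge (F.gr α β x) (F.cof β i x) u v
    - wedge (F.sc x) (F.cof α i x) u v

/-- The torsion tensor `a^{iβγ}_{αjk}`: the coefficients of the torsion form, skew-symmetric in
the pairs `(β, j)`, `(γ, k)`. -/
def a (i : Fin q) (β γ α : Fin p) (j k : Fin q) (x : Model p q) : ℝ :=
  (1 / 2) * F.torsionForm α i x (F.vec j β x) (F.vec k γ x)

/-- The curvature form
`dω_α^β - ω_α^γ ∧ ω_γ^β - q/(p+q) (δ_α^β ω_γ^k ∧ ω_k^γ - p ω_α^k ∧ ω_k^β)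
  = b^{βγδ}_{αkl} ω_γ^k ∧ ω_δ^l`. -/
def curvFormGr (α β : Fin p) (x u v : Model p q) : ℝ :=
  extD (F.gr α β) x u v
    - ∑ γ, wedge (F.gr α γ x) (F.gr γ β x) u v
    - ((q : ℝ) / (p + q)) *
      (kron α β * ∑ γ, ∑ k, wedge (F.cof γ k x) (F.pr k γ x) u v
        - p * ∑ k, wedge (F.cof α k x) (F.pr k β x) u v)

/-- The components `b^{βγδ}_{αkl}`, skew-symmetric in the pairs `(γ, k)`, `(δ, l)`. -/
def bGr (β γ δ α : Fin p) (k l : Fin q) (x : Model p q) : ℝ :=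
  (1 / 2) * F.curvFormGr α β x (F.vec k γ x) (F.vec l δ x)

/-- The curvature form
`dω_j^i - ω_j^k ∧ ω_k^i - p/(p+q) (δ_j^i ω_k^γ ∧ ω_γ^k - q ω_j^γ ∧ ω_γ^i)
  = b^{iγδ}_{jkl} ω_γ^k ∧ ω_δ^l`. -/
def curvFormLa (j i : Fin q) (x u v : Model p q) : ℝ :=
  extD (F.la j i) x u v
    - ∑ k, wedge (F.la j k x) (F.la k i x) u v
    - ((p : ℝ) / (p + q)) *
      (kron j i * ∑ k, ∑ γ, wedge (F.pr k γ x) (F.cof γ k x) u v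
        - q * ∑ γ, wedge (F.pr j γ x) (F.cof γ i x) u v)

/-- The components `b^{iγδ}_{jkl}`, skew-symmetric in the pairs `(γ, k)`, `(δ, l)`. -/
def bLa (i : Fin q) (γ δ : Fin p) (j k l : Fin q) (x : Model p q) : ℝ :=
  (1 / 2) * F.curvFormLa j i x (F.vec k γ x) (F.vec l δ x)

/-- The curvature form
`dω_i^α - ω_i^β ∧ ω_β^α - ω_i^j ∧ ω_j^α + ω ∧ ω_i^α + a^{kαβ}_{γij} ω_k^γ ∧ ω_β^j
  = c^{αβγ}_{ijk} ω_γ^k ∧ ω_β^j`. -/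
def curvFormPr (i : Fin q) (α : Fin p) (x u v : Model p q) : ℝ :=
  extD (F.pr i α) x u v
    - ∑ β, wedge (F.pr i β x) (F.gr β α x) u v
    - ∑ j, wedge (F.la i j x) (F.pr j α x) u v
    + wedge (F.sc x) (F.pr i α x) u v
    + ∑ k, ∑ γ, ∑ β, ∑ j, F.a k α β γ i j x * wedge (F.pr k γ x) (F.cof β j x) u v

/-- The components `c^{αβγ}_{ijk}`, skew-symmetric in the pairs `(β, j)`, `(γ, k)`. Note the
order `ω_γ^k ∧ ω_β^j` in the expansion. -/
def c (α β γ : Fin p) (i j k : Fin q) (x : Model p q) : ℝ :=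
  (1 / 2) * F.curvFormPr i α x (F.vec k γ x) (F.vec j β x)

/-- The Pfaffian form
`da^{iβγ}_{αjk} - a^{iβγ}_{εjk} ω_α^ε - a^{iβγ}_{αlk} ω_j^l - a^{iβγ}_{αjl} ω_k^l
  + a^{lβγ}_{αjk} ω_l^i + a^{iεγ}_{αjk} ω_ε^β + a^{iβε}_{αjk} ω_ε^γ + a^{iβγ}_{αjk} ω`. -/
def deltaA (i : Fin q) (β γ α : Fin p) (j k : Fin q) (x : Model p q) : Model p q →L[ℝ] ℝ :=
  fderiv ℝ (F.a i β γ α j k) x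
    - ∑ ε, F.a i β γ ε j k x • F.gr α ε x
    - ∑ l, F.a i β γ α l k x • F.la j l x
    - ∑ l, F.a i β γ α j l x • F.la k l x
    + ∑ l, F.a l β γ α j k x • F.la l i x
    + ∑ ε, F.a i ε γ α j k x • F.gr ε β x
    + ∑ ε, F.a i β ε α j k x • F.gr ε γ x
    + F.a i β γ α j k x • F.sc x

/-- The Pfaffian derivatives `a^{iβγδ}_{αjkl}`: coefficients of `deltaA` at `ω_δ^l`. -/
def aD (i : Fin q) (β γ δ α : Fin p) (j k l : Fin q) (x : Model p q) : ℝ :=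
  F.deltaA i β γ α j k x (F.vec l δ x)

/-- The Pfaffian form `Δb^{βγδ}_{αkl} = ∇b^{βγδ}_{αkl} + 2 b^{βγδ}_{αkl} ω
  - pq/(2(p+q)) (2 δ_ε^β a^{mγδ}_{αkl} - δ_α^γ a^{mβδ}_{εkl} + δ_α^δ a^{mβγ}_{εlk}) ω_m^ε`. -/
def deltaBGr (β γ δ α : Fin p) (k l : Fin q) (x : Model p q) : Model p q →L[ℝ] ℝ :=
  fderiv ℝ (F.bGr β γ δ α k l) x
    - ∑ ε, F.bGr β γ δ ε k l x • F.gr α ε x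
    - ∑ m, F.bGr β γ δ α m l x • F.la k m x
    - ∑ m, F.bGr β γ δ α k m x • F.la l m x
    + ∑ ε, F.bGr ε γ δ α k l x • F.gr ε β x
    + ∑ ε, F.bGr β ε δ α k l x • F.gr ε γ x
    + ∑ ε, F.bGr β γ ε α k l x • F.gr ε δ x
    + (2 * F.bGr β γ δ α k l x) • F.sc x
    - ((p * q : ℝ) / (2 * (p + q))) • ∑ m, ∑ ε,
        (2 * kron ε β * F.a m γ δ α k l x - kron α γ * F.a m β δ ε k l x
          + kron α δ * F.a m β γ ε l k x) • F.pr m ε x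

/-- The Pfaffian derivatives `b^{βγδε}_{αklm}`: coefficients of `Δb^{βγδ}_{αkl}` at `ω_ε^m`. -/
def bGrD (β γ δ ε α : Fin p) (k l m : Fin q) (x : Model p q) : ℝ :=
  F.deltaBGr β γ δ α k l x (F.vec m ε x)

/-- The Pfaffian form `Δb^{iγδ}_{jkl} = ∇b^{iγδ}_{jkl} + 2 b^{iγδ}_{jkl} ω
  + pq/(2(p+q)) (2 δ_j^m a^{iγδ}_{εkl} - δ_k^i a^{mγδ}_{εjl} + δ_l^i a^{mδγ}_{εjk}) ω_m^ε`. -/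
def deltaBLa (i : Fin q) (γ δ : Fin p) (j k l : Fin q) (x : Model p q) : Model p q →L[ℝ] ℝ :=
  fderiv ℝ (F.bLa i γ δ j k l) x
    - ∑ m, F.bLa i γ δ m k l x • F.la j m x
    - ∑ m, F.bLa i γ δ j m l x • F.la k m x
    - ∑ m, F.bLa i γ δ j k m x • F.la l m x
    + ∑ m, F.bLa m γ δ j k l x • F.la m i x
    + ∑ ε, F.bLa i ε δ j k l x • F.gr ε γ x
    + ∑ ε, F.bLa i γ ε j k l x • F.gr ε δ x
    + (2 * F.bLa i γ δ j k l x) • F.sc x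
    + ((p * q : ℝ) / (2 * (p + q))) • ∑ m, ∑ ε,
        (2 * kron j m * F.a i γ δ ε k l x - kron k i * F.a m γ δ ε j l x
          + kron l i * F.a m δ γ ε j k x) • F.pr m ε x

/-- The Pfaffian derivatives `b^{iγδε}_{jklm}`: coefficients of `Δb^{iγδ}_{jkl}` at `ω_ε^m`. -/
def bLaD (i : Fin q) (γ δ ε : Fin p) (j k l m : Fin q) (x : Model p q) : ℝ :=
  F.deltaBLa i γ δ j k l x (F.vec m ε x)

/-- `F` is a smooth moving frame in the bundle of reduced fourth-order frames of the almost
Grassmann structure `S`, over the domain of the chart `e`. -/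
structure IsReduced {M : Type*} [TopologicalSpace M] [ChartedSpace (Model p q) M]
    (S : AlmostGrassmannStructure p q M) (e : OpenPartialHomeomorph M (Model p q)) : Prop where
  /-- the `ω_α^i` form an adapted coframe -/
  adapted : IsAdaptedCoframe S.cone e F.cof
  /-- the `e_i^α` are the dual frame -/
  dual : ∀ y ∈ e.target, ∀ α i j β, F.cof α i y (F.vec j β y) = kron α β * kron i j
  smooth_vec : ∀ i α, ContDiffOn ℝ ∞ (F.vec i α) e.target
  smooth_gr : ∀ α β, ContDiffOn ℝ ∞ (F.gr α β) e.target
  smooth_la : ∀ j i, ContDiffOn ℝ ∞ (F.la j i) e.target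
  smooth_sc : ContDiffOn ℝ ∞ F.sc e.target
  smooth_pr : ∀ i α, ContDiffOn ℝ ∞ (F.pr i α) e.target
  /-- `ω_γ^γ = 0` -/
  trace_gr : ∀ y ∈ e.target, ∑ γ, F.gr γ γ y = 0
  /-- `ω_k^k = 0` -/
  trace_la : ∀ y ∈ e.target, ∑ k, F.la k k y = 0
  /-- reduction of the second-order frames: `a^{iαγ}_{αjk} = 0` -/
  trace_a_gr : ∀ y ∈ e.target, ∀ i γ j k, ∑ α, F.a i α γ α j k y = 0
  /-- reduction of the second-order frames: `a^{iβγ}_{αik} = 0` -/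
  trace_a_la : ∀ y ∈ e.target, ∀ β γ α k, ∑ i, F.a i β γ α i k y = 0
  /-- the third-order forms `ω_i^α` satisfy `dω = ω_i^α ∧ ω_α^i` -/
  d_sc : ∀ y ∈ e.target, ∀ u v,
    extD F.sc y u v = ∑ i, ∑ α, wedge (F.pr i α y) (F.cof α i y) u v
  /-- reduction of the fourth-order frames:
  `b^{γαδ}_{αkl} - b^{iγδ}_{kil} + b^{δαγ}_{αlk} - b^{iδγ}_{lik} = 0` -/
  trace_b : ∀ y ∈ e.target, ∀ γ δ k l,
    ∑ α, F.bGr γ α δ α k l y - ∑ i, F.bLa i γ δ k i l y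
      + ∑ α, F.bGr δ α γ α l k y - ∑ i, F.bLa i δ γ l i k y = 0

end MovingFrame

/-- Names of the components of `a = {a^{iβγ}_{αjk}}` and `{b^{βγδ}_{αkl}}`, and of their
Pfaffian derivatives. -/
inductive VarGr (p q : ℕ) : Type
  | a (i : Fin q) (β γ α : Fin p) (j k : Fin q)
  | aD (i : Fin q) (β γ δ α : Fin p) (j k l : Fin q)
  | b (β γ δ α : Fin p) (k l : Fin q)
  | bD (β γ δ ε α : Fin p) (k l m : Fin q)

/-- Names of the components of `a = {a^{iβγ}_{αjk}}` and `{b^{iγδ}_{jkl}}`, and of their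
Pfaffian derivatives. -/
inductive VarLa (p q : ℕ) : Type
  | a (i : Fin q) (β γ α : Fin p) (j k : Fin q)
  | aD (i : Fin q) (β γ δ α : Fin p) (j k l : Fin q)
  | b (i : Fin q) (γ δ : Fin p) (j k l : Fin q)
  | bD (i : Fin q) (γ δ ε : Fin p) (j k l m : Fin q)

/-- The values of these components at a point of a moving frame. -/
def MovingFrame.valGr {p q : ℕ} (F : MovingFrame p q) (y : Model p q) : VarGr p q → ℝ
  | .a i β γ α j k => F.a i β γ α j k y
  | .aD i β γ δ α j k l => F.aD i β γ δ α j k l y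
  | .b β γ δ α k l => F.bGr β γ δ α k l y
  | .bD β γ δ ε α k l m => F.bGrD β γ δ ε α k l m y

/-- The values of these components at a point of a moving frame. -/
def MovingFrame.valLa {p q : ℕ} (F : MovingFrame p q) (y : Model p q) : VarLa p q → ℝ
  | .a i β γ α j k => F.a i β γ α j k y
  | .aD i β γ δ α j k l => F.aD i β γ δ α j k l y
  | .b i γ δ j k l => F.bLa i γ δ j k l y
  | .bD i γ δ ε j k l m => F.bLaD i γ δ ε j k l m y

end AlmostGrassmann

end

/-! Write K = pq/(p+q), let A_α^i be the torsion forms and Ω_i^α the curvature forms of the ω_i^α,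
whose coefficients are c. Exterior differentiation of the structure equation of ω_α^β gives a
Bianchi identity in which dω_k^β enters only through ω_α^k ∧ dω_k^β. After substitution of the other
structure equations, the connection terms combine with db into ∇b + 2bω, and the terms that still
contain ω_i^α are exactly the correction in the Pfaffian form Δb. What remains is K ω_α^k ∧ Ω_k^β =
-(Δb^{βγδ}_{αkl} ∧ ω_γ^k ∧ ω_δ^l + 2 b^{βγδ}_{αkl} ω_δ^l ∧ A_γ^k), which is `sum_wedge₃_curvature`.

Evaluate this on three frame vectors, the first carrying the free lower index of b and the other two
carrying Greek indices different from it. The left side collapses to one value of Ω, that is, to one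
component of c (`curvature_apply`, `mul_c_eq_gr`). Such an index avoids two given ones, so it exists
when p > 2.

The case q > 2 is the same lemma after transposition: exchanging Greek with Latin indices and
replacing ω_α^β, ω_j^i by their negative transposes preserves the structure equations
(`mul_c_eq_la`). -/

noncomputable section

namespace AlmostGrassmann

open Topology Filter

/-! ### Exterior calculus of 1-forms and 2-forms on a normed space. -/

section Exterior

variable {E : Type*} [NormedAddCommGroup E] [NormedSpace ℝ E]

/-- The exterior product of two covectors, as a function of two vectors. -/
def wedge₂ (μ ν : E →L[ℝ] ℝ) : E → E → ℝ := fun u v => μ u * ν v - μ v * ν u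

/-- The exterior product of a covector and a skew-symmetric function of two vectors. -/
def wedge₃ : (E →L[ℝ] ℝ) →ₗ[ℝ] (E → E → ℝ) →ₗ[ℝ] (E → E → E → ℝ) :=
  LinearMap.mk₂ ℝ (fun μ G u v w => μ u * G v w + μ v * G w u + μ w * G u v)
    (fun _ _ _ => by ext; simp; ring) (fun _ _ _ => by ext; simp; ring)
    (fun _ _ _ => by ext; simp; ring) (fun _ _ _ => by ext; simp; ring)

theorem wedge₃_apply (μ : E →L[ℝ] ℝ) (G : E → E → ℝ) (u v w : E) :
    wedge₃ μ G u v w = μ u * G v w + μ v * G w u + μ w * G u v := rfl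

theorem wedge₂_swap (μ ν : E →L[ℝ] ℝ) : wedge₂ μ ν = -wedge₂ ν μ := by
  ext u v; simp [wedge₂]; ring

theorem wedge₃_swap (μ ν ρ : E →L[ℝ] ℝ) :
    wedge₃ μ (wedge₂ ν ρ) = -wedge₃ μ (wedge₂ ρ ν) := by
  rw [wedge₂_swap, map_neg]

theorem wedge₃_cycle (μ ν ρ : E →L[ℝ] ℝ) :
    wedge₃ μ (wedge₂ ν ρ) = wedge₃ ν (wedge₂ ρ μ) := by
  ext u v w; simp only [wedge₃_apply, wedge₂]; ring

theorem wedge₃_swap_left (μ ν ρ : E →L[ℝ] ℝ) :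
    wedge₃ μ (wedge₂ ν ρ) = -wedge₃ ν (wedge₂ μ ρ) := by
  rw [wedge₃_cycle, wedge₃_swap]

/-- The exterior differential of a 1-form, as a function of two vectors. -/
def dOne (μ : E → E →L[ℝ] ℝ) (x : E) : E → E → ℝ :=
  fun u v => fderiv ℝ μ x u v - fderiv ℝ μ x v u

/-- The skew-symmetric bilinear functions of two vectors. -/
def skewForms (E : Type*) [NormedAddCommGroup E] [NormedSpace ℝ E] :
    Submodule ℝ (E → E → ℝ) where
  carrier := {G | (∀ v, IsLinearMap ℝ fun u => G u v) ∧ ∀ u v, G u v = -G v u}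
  zero_mem' := ⟨fun _ => ⟨by simp, by simp⟩, by simp⟩
  add_mem' := by
    rintro G H ⟨hG, hG'⟩ ⟨hH, hH'⟩
    refine ⟨fun v => ⟨fun x y => ?_, fun c x => ?_⟩, fun u v => ?_⟩
    · simp only [Pi.add_apply, (hG v).map_add, (hH v).map_add]; ring
    · simp only [Pi.add_apply, (hG v).map_smul, (hH v).map_smul, smul_add]
    · simp only [Pi.add_apply, hG' u v, hH' u v]; ring
  smul_mem' := by
    rintro c G ⟨hG, hG'⟩
    refine ⟨fun v => ⟨fun x y => ?_, fun d x => ?_⟩, fun u v => ?_⟩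
    · simp only [Pi.smul_apply, (hG v).map_add, smul_add]
    · simp only [Pi.smul_apply, (hG v).map_smul, smul_comm c d]
    · simp only [Pi.smul_apply, hG' u v, smul_neg]

theorem wedge₂_mem_skewForms (μ ν : E →L[ℝ] ℝ) : wedge₂ μ ν ∈ skewForms E := by
  refine ⟨fun v => ⟨fun x y => ?_, fun c x => ?_⟩, fun u v => ?_⟩ <;>
    simp only [wedge₂, map_add, map_smul, smul_eq_mul] <;> ring

/-- A skew-symmetric form in terms of a frame `e` and its dual coframe `θ`. -/
theorem eq_sum_wedge₂_of_mem_skewForms {ι : Type*} [Fintype ι] {e : ι → E}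
    {θ : ι → E →L[ℝ] ℝ} (he : ∀ v, v = ∑ s, θ s v • e s) {G : E → E → ℝ}
    (hG : G ∈ skewForms E) :
    G = ∑ s, ∑ t, ((1 / 2) * G (e s) (e t)) • wedge₂ (θ s) (θ t) := by
  obtain ⟨hlin, hskew⟩ := hG
  have h1 : ∀ u v, G u v = ∑ s, θ s u * G (e s) v := fun u v => by
    conv_lhs => rw [he u]
    refine (map_sum ((hlin v).mk') (fun s => θ s u • e s) Finset.univ).trans ?_
    exact Finset.sum_congr rfl fun s _ => (hlin v).map_smul _ _
  have h2 : ∀ u v, G u v = ∑ s, ∑ t, θ s u * θ t v * G (e s) (e t) := fun u v => by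
    rw [h1 u v]
    refine Finset.sum_congr rfl fun s _ => ?_
    rw [hskew, h1, ← Finset.sum_neg_distrib, Finset.mul_sum]
    refine Finset.sum_congr rfl fun t _ => ?_
    rw [hskew (e t)]; ring
  ext u v
  have h3 : ∑ s, ∑ t, θ s v * θ t u * G (e s) (e t) = - G u v := by
    rw [← h2 v u, hskew]
  -- Antisymmetrizing the bilinear expansion produces the wedge products. The sum runs over ordered
  -- pairs, hence the factor 1/2.
  have h4 : G u v = (1 / 2) * (G u v - -G u v) := by ring
  rw [h4, ← h3]
  conv_lhs => rw [h2 u v]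
  simp only [Finset.sum_apply, Pi.smul_apply, smul_eq_mul, wedge₂, ← Finset.sum_sub_distrib,
    Finset.mul_sum]
  refine Finset.sum_congr rfl fun s _ => Finset.sum_congr rfl fun t _ => ?_
  ring

/-- `T` is the exterior differential at `x` of the field `G` of functions of two vectors. -/
def HasExtDeriv (G : E → E → E → ℝ) (T : E → E → E → ℝ) (x : E) : Prop :=
  ∃ G' : E → E → E →L[ℝ] ℝ, (∀ u v, HasFDerivAt (fun z => G z u v) (G' u v) x) ∧
    ∀ u v w, T u v w = G' v w u + G' w u v + G' u v w

namespace HasExtDeriv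

variable {G H : E → E → E → ℝ} {S T : E → E → E → ℝ} {x : E}

/-- The fields must agree near the point, since their values are differentiated there. -/
theorem unique (hT : HasExtDeriv G T x) (hS : HasExtDeriv H S x) (h : G =ᶠ[𝓝 x] H) :
    T = S := by
  obtain ⟨G', hG, hT⟩ := hT
  obtain ⟨H', hH, hS⟩ := hS
  have : G' = H' := by
    ext1 u; ext1 v
    exact (hG u v).unique ((hH u v).congr_of_eventuallyEq (h.mono fun z hz => congrFun₂ hz u v))
  ext u v w
  rw [hT, hS, this]

theorem add (hT : HasExtDeriv G T x) (hS : HasExtDeriv H S x) :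
    HasExtDeriv (fun z => G z + H z) (T + S) x := by
  obtain ⟨G', hG, hT⟩ := hT
  obtain ⟨H', hH, hS⟩ := hS
  refine ⟨fun u v => G' u v + H' u v, fun u v => (hG u v).add (hH u v), fun u v w => ?_⟩
  simp only [Pi.add_apply, hT, hS, add_apply]; ring

theorem const_smul (c : ℝ) (hT : HasExtDeriv G T x) :
    HasExtDeriv (fun z => c • G z) (c • T) x := by
  obtain ⟨G', hG, hT⟩ := hT
  refine ⟨fun u v => c • G' u v, fun u v => (hG u v).const_mul c, fun u v w => ?_⟩
  simp only [Pi.smul_apply, hT, smul_apply, smul_eq_mul]; ring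

theorem sub (hT : HasExtDeriv G T x) (hS : HasExtDeriv H S x) :
    HasExtDeriv (fun z => G z - H z) (T - S) x := by
  have := hT.add (hS.const_smul (-1))
  simpa only [neg_one_smul, ← sub_eq_add_neg] using this

theorem sum {ι : Type*} (s : Finset ι) {G : ι → E → E → E → ℝ} {T : ι → E → E → E → ℝ}
    (h : ∀ i, HasExtDeriv (G i) (T i) x) :
    HasExtDeriv (fun z => ∑ i ∈ s, G i z) (∑ i ∈ s, T i) x := by
  choose G' hG hT using h
  refine ⟨fun u v => ∑ i ∈ s, G' i u v, fun u v => ?_, fun u v w => ?_⟩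
  · simp only [Finset.sum_apply]
    exact HasFDerivAt.fun_sum fun i _ => hG i u v
  · simp only [Finset.sum_apply, hT, sum_apply, Finset.sum_add_distrib]

theorem smul {f : E → ℝ} (hf : DifferentiableAt ℝ f x) (hT : HasExtDeriv G T x) :
    HasExtDeriv (fun z => f z • G z) (wedge₃ (fderiv ℝ f x) (G x) + f x • T) x := by
  obtain ⟨G', hG, hT⟩ := hT
  refine ⟨fun u v => f x • G' u v + G x u v • fderiv ℝ f x,
    fun u v => hf.hasFDerivAt.mul (hG u v), fun u v w => ?_⟩
  simp only [Pi.add_apply, Pi.smul_apply, wedge₃_apply, hT, add_apply,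
    smul_apply, smul_eq_mul]
  ring

/-- This is dμ ∧ ν - μ ∧ dν; a 2-form commutes with a 1-form, so the covector can be put first in
both terms. -/
theorem wedge {μ ν : E → E →L[ℝ] ℝ} (hμ : DifferentiableAt ℝ μ x)
    (hν : DifferentiableAt ℝ ν x) :
    HasExtDeriv (fun z => wedge₂ (μ z) (ν z))
      (wedge₃ (ν x) (dOne μ x) - wedge₃ (μ x) (dOne ν x)) x := by
  have hμ' := fun u => hμ.hasFDerivAt.clm_apply (hasFDerivAt_const u x)
  have hν' := fun u => hν.hasFDerivAt.clm_apply (hasFDerivAt_const u x)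
  refine ⟨_, fun u v => ((hμ' u).mul (hν' v)).sub ((hμ' v).mul (hν' u)), fun u v w => ?_⟩
  simp [wedge₃_apply, dOne]
  ring

/-- d² = 0 by symmetry of the second derivative, which is where C² is used. -/
theorem dOne {μ : E → E →L[ℝ] ℝ} (hμ : ContDiffAt ℝ 2 μ x) :
    HasExtDeriv (dOne μ) 0 x := by
  have hd : DifferentiableAt ℝ (fderiv ℝ μ) x :=
    (hμ.fderiv_right (m := 1) (by norm_num)).differentiableAt (by norm_num)
  have hd' := fun u v => (hd.hasFDerivAt.clm_apply (hasFDerivAt_const u x)).clm_apply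
    (hasFDerivAt_const v x)
  have hsymm : IsSymmSndFDerivAt ℝ μ x := hμ.isSymmSndFDerivAt (by simp)
  refine ⟨_, fun u v => (hd' u v).sub (hd' v u), fun u v w => ?_⟩
  have h : ∀ a b c, fderiv ℝ (fderiv ℝ μ) x a b c = fderiv ℝ (fderiv ℝ μ) x b a c :=
    fun a b c => by rw [hsymm a b]
  simp
  rw [h v u w, h w v u, h w u v]
  ring

end HasExtDeriv

end Exterior

/-! ### The Bianchi identity as exterior algebra at a single point. -/

section BianchiAlgebra

theorem sum_four_swap {ι κ V : Type*} [Fintype ι] [Fintype κ] [AddCommMonoid V]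
    (f : ι → κ → ι → κ → V) :
    ∑ γ, ∑ k, ∑ δ, ∑ l, f γ k δ l = ∑ γ, ∑ k, ∑ δ, ∑ l, f δ l γ k := by
  have h := Finset.sum_comm (s := (Finset.univ : Finset (ι × κ)))
    (t := (Finset.univ : Finset (ι × κ))) (f := fun s t => f s.1 s.2 t.1 t.2)
  simpa only [Fintype.sum_prod_type] using h

variable {E : Type*} [NormedAddCommGroup E] [NormedSpace ℝ E] {p q : ℕ}
  {θ : Fin p → Fin q → E →L[ℝ] ℝ} {φ : Fin p → Fin p → E →L[ℝ] ℝ}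
  {ψ : Fin q → Fin q → E →L[ℝ] ℝ} {τ : E →L[ℝ] ℝ} {π : Fin q → Fin p → E →L[ℝ] ℝ}
  {dθ : Fin p → Fin q → E → E → ℝ} {dφ : Fin p → Fin p → E → E → ℝ} {dτ : E → E → ℝ}
  {dπ : Fin q → Fin p → E → E → ℝ} {A : Fin p → Fin q → E → E → ℝ}
  {B : Fin p → Fin p → E → E → ℝ} {C : Fin q → Fin p → E → E → ℝ}
  {a : Fin q → Fin p → Fin p → Fin p → Fin q → Fin q → ℝ}
  {K K' : ℝ}

/-- The terms cubic in φ cancel by associativity, and dτ cancels because it multiplies the identity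
matrix. The surviving mixed terms in φ, θ, π are those that `sum_wedge₃_dθ_dπ` cancels. -/
theorem sum_wedge₃_dφ
    (hφ : ∀ α β, dφ α β = ∑ γ, wedge₂ (φ α γ) (φ γ β) - (K' * kron α β) • dτ
      - K • ∑ k, wedge₂ (θ α k) (π k β) + B α β) (α β : Fin p) :
    ∑ γ, (wedge₃ (φ γ β) (dφ α γ) - wedge₃ (φ α γ) (dφ γ β)) =
      ∑ γ, (wedge₃ (φ γ β) (B α γ) - wedge₃ (φ α γ) (B γ β))
      - K • ∑ k, ∑ γ, (wedge₃ (φ γ β) (wedge₂ (θ α k) (π k γ))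
        - wedge₃ (φ α γ) (wedge₂ (θ γ k) (π k β))) := by
  have h1 : ∑ γ, ∑ ε, wedge₃ (φ γ β) (wedge₂ (φ α ε) (φ ε γ))
      = ∑ γ, ∑ ε, wedge₃ (φ α γ) (wedge₂ (φ γ ε) (φ ε β)) := by
    rw [Finset.sum_comm]
    refine Finset.sum_congr rfl fun γ _ => Finset.sum_congr rfl fun ε _ => ?_
    rw [wedge₃_cycle]
  have h2 : ∑ γ, (K' * kron α γ) • wedge₃ (φ γ β) dτ
      = ∑ γ, (K' * kron γ β) • wedge₃ (φ α γ) dτ := by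
    simp [kron]
  have h3 : ∀ f : Fin q → Fin p → E → E → E → ℝ, ∑ k, ∑ γ, f k γ = ∑ γ, ∑ k, f k γ :=
    fun f => Finset.sum_comm
  simp only [h3, hφ, map_add, map_sub, map_sum, map_smul, Finset.sum_add_distrib,
    Finset.sum_sub_distrib]
  rw [h1, h2]
  simp only [smul_sub, Finset.smul_sum]
  module

/-- The forms ψ act only on the contracted Latin index, and τ acts with opposite weights on θ and π,
so both drop out. -/
theorem sum_wedge₃_dθ_dπ
    (hθ : ∀ α i, dθ α i = ∑ j, wedge₂ (θ α j) (ψ j i) + ∑ β, wedge₂ (φ α β) (θ β i)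
      + wedge₂ τ (θ α i) + A α i)
    (hπ : ∀ i α, dπ i α = ∑ β, wedge₂ (π i β) (φ β α) + ∑ j, wedge₂ (ψ i j) (π j α)
      - wedge₂ τ (π i α) - ∑ k, ∑ γ, ∑ β, ∑ j, a k α β γ i j • wedge₂ (π k γ) (θ β j)
      + C i α) (α β : Fin p) :
    ∑ k, (wedge₃ (π k β) (dθ α k) - wedge₃ (θ α k) (dπ k β)) =
      ∑ k, wedge₃ (π k β) (A α k) - ∑ k, wedge₃ (θ α k) (C k β)
      + ∑ k, ∑ m, ∑ γ, ∑ δ, ∑ j, a m β δ γ k j • wedge₃ (θ α k) (wedge₂ (π m γ) (θ δ j))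
      - ∑ k, ∑ γ, (wedge₃ (φ γ β) (wedge₂ (θ α k) (π k γ))
        - wedge₃ (φ α γ) (wedge₂ (θ γ k) (π k β))) := by
  have h1 : ∑ k, ∑ j, wedge₃ (π k β) (wedge₂ (θ α j) (ψ j k))
      = ∑ k, ∑ j, wedge₃ (θ α k) (wedge₂ (ψ k j) (π j β)) := by
    rw [Finset.sum_comm]
    refine Finset.sum_congr rfl fun γ _ => Finset.sum_congr rfl fun ε _ => ?_
    rw [wedge₃_cycle]
  have h2 : ∀ k, wedge₃ (π k β) (wedge₂ τ (θ α k)) = - wedge₃ (θ α k) (wedge₂ τ (π k β)) :=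
    fun k => by rw [wedge₃_swap, wedge₃_cycle]
  have h3 : ∀ k γ, wedge₃ (φ γ β) (wedge₂ (θ α k) (π k γ))
      = wedge₃ (θ α k) (wedge₂ (π k γ) (φ γ β)) := fun _ _ => wedge₃_cycle _ _ _
  have h4 : ∀ k γ, wedge₃ (φ α γ) (wedge₂ (θ γ k) (π k β))
      = wedge₃ (π k β) (wedge₂ (φ α γ) (θ γ k)) := fun _ _ => (wedge₃_cycle _ _ _).symm
  simp only [hθ, hπ, h2, h3, h4, map_add, map_sub, map_sum, map_smul, Finset.sum_add_distrib,
    Finset.sum_sub_distrib, Finset.sum_neg_distrib]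
  rw [h1]
  module

/-- Each connection form in dθ is moved onto b, giving the covariant differential in the two
vertical index pairs. The form τ occurs once for each factor θ, hence 2b τ; the factor 2 before the
torsion comes from the skew symmetry of b. -/
theorem sum_smul_wedge₃_dθ
    (hθ : ∀ α i, dθ α i = ∑ j, wedge₂ (θ α j) (ψ j i) + ∑ β, wedge₂ (φ α β) (θ β i)
      + wedge₂ τ (θ α i) + A α i)
    {b : Fin p → Fin p → Fin q → Fin q → ℝ} (hb : ∀ γ δ k l, b γ δ k l = -b δ γ l k) :
    ∑ γ, ∑ k, ∑ δ, ∑ l, b γ δ k l • (wedge₃ (θ δ l) (dθ γ k) - wedge₃ (θ γ k) (dθ δ l)) =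
      (2 : ℝ) • ∑ γ, ∑ k, ∑ δ, ∑ l, b γ δ k l • wedge₃ (θ δ l) (A γ k)
      + ∑ γ, ∑ k, ∑ δ, ∑ l, wedge₃ (- ∑ m, b γ δ m l • ψ k m - ∑ m, b γ δ k m • ψ l m
        + ∑ ε, b ε δ k l • φ ε γ + ∑ ε, b γ ε k l • φ ε δ + (2 * b γ δ k l) • τ)
          (wedge₂ (θ γ k) (θ δ l)) := by
  have h0 : ∑ γ, ∑ k, ∑ δ, ∑ l, b γ δ k l • wedge₃ (θ γ k) (dθ δ l)
      = - ∑ γ, ∑ k, ∑ δ, ∑ l, b γ δ k l • wedge₃ (θ δ l) (dθ γ k) := by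
    rw [sum_four_swap]
    simp only [← Finset.sum_neg_distrib]
    refine Finset.sum_congr rfl fun γ _ => Finset.sum_congr rfl fun k _ =>
      Finset.sum_congr rfl fun δ _ => Finset.sum_congr rfl fun l _ => ?_
    rw [hb δ, neg_smul]
  have hψ : ∑ γ, ∑ k, ∑ δ, ∑ l, ∑ m, b γ δ k m • wedge₃ (ψ l m) (wedge₂ (θ γ k) (θ δ l))
      = ∑ γ, ∑ k, ∑ δ, ∑ l, ∑ m, b γ δ m l • wedge₃ (ψ k m) (wedge₂ (θ γ k) (θ δ l)) := by
    rw [sum_four_swap]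
    refine Finset.sum_congr rfl fun γ _ => Finset.sum_congr rfl fun k _ =>
      Finset.sum_congr rfl fun δ _ => Finset.sum_congr rfl fun l _ =>
      Finset.sum_congr rfl fun m _ => ?_
    rw [hb δ, wedge₃_swap, smul_neg, neg_smul, neg_neg]
  have hφ : ∑ γ, ∑ k, ∑ δ, ∑ l, ∑ ε, b γ ε k l • wedge₃ (φ ε δ) (wedge₂ (θ γ k) (θ δ l))
      = ∑ γ, ∑ k, ∑ δ, ∑ l, ∑ ε, b ε δ k l • wedge₃ (φ ε γ) (wedge₂ (θ γ k) (θ δ l)) := by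
    rw [sum_four_swap]
    refine Finset.sum_congr rfl fun γ _ => Finset.sum_congr rfl fun k _ =>
      Finset.sum_congr rfl fun δ _ => Finset.sum_congr rfl fun l _ =>
      Finset.sum_congr rfl fun m _ => ?_
    rw [hb δ, wedge₃_swap, smul_neg, neg_smul, neg_neg]
  have hψ' : ∑ γ, ∑ k, ∑ δ, ∑ l, ∑ m, b γ δ k l • wedge₃ (θ δ l) (wedge₂ (θ γ m) (ψ m k))
      = - ∑ γ, ∑ k, ∑ δ, ∑ l, ∑ m, b γ δ m l • wedge₃ (ψ k m) (wedge₂ (θ γ k) (θ δ l)) := by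
    simp only [← Finset.sum_neg_distrib]
    refine Finset.sum_congr rfl fun γ _ => ?_
    have e : ∀ f : Fin q → Fin p → Fin q → Fin q → E → E → E → ℝ,
        ∑ k, ∑ δ, ∑ l, ∑ m, f k δ l m = ∑ δ, ∑ l, ∑ k, ∑ m, f k δ l m := fun f => by
      rw [Finset.sum_comm]
      exact Finset.sum_congr rfl fun _ _ => Finset.sum_comm
    rw [e, e]
    refine Finset.sum_congr rfl fun δ _ => Finset.sum_congr rfl fun l _ => ?_
    rw [Finset.sum_comm]
    refine Finset.sum_congr rfl fun k _ => Finset.sum_congr rfl fun m _ => ?_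
    rw [← wedge₃_cycle, wedge₃_swap, smul_neg]
  have hφ' : ∑ γ, ∑ k, ∑ δ, ∑ l, ∑ ε, b γ δ k l • wedge₃ (θ δ l) (wedge₂ (φ γ ε) (θ ε k))
      = ∑ γ, ∑ k, ∑ δ, ∑ l, ∑ ε, b ε δ k l • wedge₃ (φ ε γ) (wedge₂ (θ γ k) (θ δ l)) := by
    have e : ∀ f : Fin p → Fin q → Fin p → Fin q → Fin p → E → E → E → ℝ,
        ∑ γ, ∑ k, ∑ δ, ∑ l, ∑ m, f γ k δ l m
          = ∑ k, ∑ δ, ∑ l, ∑ γ, ∑ m, f γ k δ l m := fun f => by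
      rw [Finset.sum_comm]
      refine Finset.sum_congr rfl fun _ _ => ?_
      rw [Finset.sum_comm]
      exact Finset.sum_congr rfl fun _ _ => Finset.sum_comm
    rw [e, e]
    refine Finset.sum_congr rfl fun k _ => Finset.sum_congr rfl fun δ _ =>
      Finset.sum_congr rfl fun l _ => ?_
    rw [Finset.sum_comm]
    refine Finset.sum_congr rfl fun γ _ => Finset.sum_congr rfl fun ε _ => ?_
    rw [wedge₃_cycle]
  have hτ : ∀ γ k δ l, wedge₃ (θ δ l) (wedge₂ τ (θ γ k)) = wedge₃ τ (wedge₂ (θ γ k) (θ δ l)) :=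
    fun _ _ _ _ => wedge₃_cycle _ _ _
  simp only [smul_sub, Finset.sum_sub_distrib]
  rw [h0]
  simp only [hθ, hτ, map_add, map_sub, map_neg, map_sum, map_smul, smul_add, Finset.smul_sum,
    LinearMap.add_apply, LinearMap.sub_apply, LinearMap.neg_apply, LinearMap.sum_apply,
    LinearMap.smul_apply, Finset.sum_add_distrib, Finset.sum_sub_distrib,
    Finset.sum_neg_distrib, mul_smul]
  rw [hψ, hφ, hψ', hφ']
  simp only [← Finset.smul_sum]
  module

/-- This explains the coefficients 2, -1, 1 in Δb. The last two terms are exchanged by swapping the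
pairs (γ,k) and (δ,l), so they contribute equally; with the factor K/2 the total is exactly the part
of the Bianchi identity that contains π. -/
theorem sum_wedge₃_π
    (hA : ∀ α i, A α i = ∑ β, ∑ j, ∑ γ, ∑ k, a i β γ α j k • wedge₂ (θ β j) (θ γ k))
    (α β : Fin p) :
    ∑ γ, ∑ k, ∑ δ, ∑ l, wedge₃ ((K / 2) • ∑ m, ∑ ε, (2 * kron ε β * a m γ δ α k l
        - kron α γ * a m β δ ε k l + kron α δ * a m β γ ε l k) • π m ε)
          (wedge₂ (θ γ k) (θ δ l))
      = K • (∑ k, wedge₃ (π k β) (A α k)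
      + ∑ k, ∑ m, ∑ γ, ∑ δ, ∑ j,
        a m β δ γ k j • wedge₃ (θ α k) (wedge₂ (π m γ) (θ δ j))) := by
  have h1 : ∑ γ, ∑ k, ∑ δ, ∑ l, ∑ m, ∑ ε,
        (2 * kron ε β * a m γ δ α k l) • wedge₃ (π m ε) (wedge₂ (θ γ k) (θ δ l))
      = (2 : ℝ) • ∑ k, wedge₃ (π k β) (A α k) := by
    have e : ∀ f : Fin p → Fin q → Fin p → Fin q → Fin q → E → E → E → ℝ,
        ∑ γ, ∑ k, ∑ δ, ∑ l, ∑ m, f γ k δ l m = ∑ m, ∑ γ, ∑ k, ∑ δ, ∑ l, f γ k δ l m := fun f => by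
      have h := Finset.sum_comm (s := (Finset.univ : Finset (Fin p × Fin q × Fin p × Fin q)))
        (t := (Finset.univ : Finset (Fin q))) (f := fun s m => f s.1 s.2.1 s.2.2.1 s.2.2.2 m)
      simpa only [Fintype.sum_prod_type] using h
    rw [e]
    simp only [hA, map_sum, map_smul, Finset.smul_sum]
    refine Finset.sum_congr rfl fun m _ => Finset.sum_congr rfl fun γ _ =>
      Finset.sum_congr rfl fun k _ => Finset.sum_congr rfl fun δ _ =>
      Finset.sum_congr rfl fun l _ => ?_
    simp [kron, mul_smul]
  have h2 : ∑ γ, ∑ k, ∑ δ, ∑ l, ∑ m, ∑ ε,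
        (kron α γ * a m β δ ε k l) • wedge₃ (π m ε) (wedge₂ (θ γ k) (θ δ l))
      = - ∑ k, ∑ m, ∑ γ, ∑ δ, ∑ j,
        a m β δ γ k j • wedge₃ (θ α k) (wedge₂ (π m γ) (θ δ j)) := by
    have e : ∀ f : Fin p → Fin q → Fin q → Fin p → E → E → E → ℝ,
        ∑ δ, ∑ l, ∑ m, ∑ ε, f δ l m ε = ∑ m, ∑ ε, ∑ δ, ∑ l, f δ l m ε := fun f => by
      have h := Finset.sum_comm (s := (Finset.univ : Finset (Fin p × Fin q)))
        (t := (Finset.univ : Finset (Fin q × Fin p))) (f := fun s t => f s.1 s.2 t.1 t.2)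
      simpa only [Fintype.sum_prod_type] using h
    rw [Finset.sum_eq_single α (fun γ _ h => by simp [kron, h.symm]) (by simp)]
    simp only [← Finset.sum_neg_distrib]
    refine Finset.sum_congr rfl fun k _ => ?_
    rw [e]
    refine Finset.sum_congr rfl fun m _ => Finset.sum_congr rfl fun ε _ =>
      Finset.sum_congr rfl fun δ _ => Finset.sum_congr rfl fun l _ => ?_
    rw [wedge₃_swap_left, smul_neg]
    simp [kron]
  have h3 : ∑ γ, ∑ k, ∑ δ, ∑ l, ∑ m, ∑ ε,
        (kron α δ * a m β γ ε l k) • wedge₃ (π m ε) (wedge₂ (θ γ k) (θ δ l))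
      = - ∑ γ, ∑ k, ∑ δ, ∑ l, ∑ m, ∑ ε,
        (kron α γ * a m β δ ε k l) • wedge₃ (π m ε) (wedge₂ (θ γ k) (θ δ l)) := by
    rw [sum_four_swap]
    simp only [← Finset.sum_neg_distrib]
    refine Finset.sum_congr rfl fun γ _ => Finset.sum_congr rfl fun k _ =>
      Finset.sum_congr rfl fun δ _ => Finset.sum_congr rfl fun l _ =>
      Finset.sum_congr rfl fun m _ => Finset.sum_congr rfl fun ε _ => ?_
    rw [wedge₃_swap, smul_neg]
  simp only [map_sum, map_smul, LinearMap.sum_apply, LinearMap.smul_apply, map_add, map_sub,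
    LinearMap.add_apply, LinearMap.sub_apply, add_smul, sub_smul]
  simp only [Finset.sum_add_distrib, Finset.sum_sub_distrib, ← Finset.smul_sum]
  rw [h3, h1, h2]
  module

/-- The Bianchi identity for the forms `φ`, solved for the curvature `C` of the forms `π`:
in terms of the Pfaffian form `Δ` of the components `b` the forms `π` drop out. -/
theorem sum_wedge₃_curvature
    {b : Fin p → Fin p → Fin p → Fin p → Fin q → Fin q → ℝ}
    {db Δ : Fin p → Fin p → Fin p → Fin p → Fin q → Fin q → E →L[ℝ] ℝ}
    (hθ : ∀ α i, dθ α i = ∑ j, wedge₂ (θ α j) (ψ j i) + ∑ β, wedge₂ (φ α β) (θ β i)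
      + wedge₂ τ (θ α i) + A α i)
    (hφ : ∀ α β, dφ α β = ∑ γ, wedge₂ (φ α γ) (φ γ β) - (K' * kron α β) • dτ
      - K • ∑ k, wedge₂ (θ α k) (π k β) + B α β)
    (hπ : ∀ i α, dπ i α = ∑ β, wedge₂ (π i β) (φ β α) + ∑ j, wedge₂ (ψ i j) (π j α)
      - wedge₂ τ (π i α) - ∑ k, ∑ γ, ∑ β, ∑ j, a k α β γ i j • wedge₂ (π k γ) (θ β j)
      + C i α)
    (hA : ∀ α i, A α i = ∑ β, ∑ j, ∑ γ, ∑ k, a i β γ α j k • wedge₂ (θ β j) (θ γ k))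
    (hB : ∀ α β, B α β = ∑ γ, ∑ k, ∑ δ, ∑ l, b β γ δ α k l • wedge₂ (θ γ k) (θ δ l))
    (hb : ∀ β γ δ α k l, b β γ δ α k l = -b β δ γ α l k)
    (hΔ : ∀ β γ δ α k l, Δ β γ δ α k l = db β γ δ α k l
      - ∑ ε, b β γ δ ε k l • φ α ε - ∑ m, b β γ δ α m l • ψ k m - ∑ m, b β γ δ α k m • ψ l m
      + ∑ ε, b ε γ δ α k l • φ ε β + ∑ ε, b β ε δ α k l • φ ε γ + ∑ ε, b β γ ε α k l • φ ε δ
      + (2 * b β γ δ α k l) • τ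
      - (K / 2) • ∑ m, ∑ ε, (2 * kron ε β * a m γ δ α k l - kron α γ * a m β δ ε k l
          + kron α δ * a m β γ ε l k) • π m ε) (α β : Fin p)
    (closed : ∑ γ, (wedge₃ (φ γ β) (dφ α γ) - wedge₃ (φ α γ) (dφ γ β))
      - K • ∑ k, (wedge₃ (π k β) (dθ α k) - wedge₃ (θ α k) (dπ k β))
      + ∑ γ, ∑ k, ∑ δ, ∑ l, (wedge₃ (db β γ δ α k l) (wedge₂ (θ γ k) (θ δ l))
        + b β γ δ α k l • (wedge₃ (θ δ l) (dθ γ k) - wedge₃ (θ γ k) (dθ δ l))) = 0) :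
    K • ∑ k, wedge₃ (θ α k) (C k β) =
      - (∑ γ, ∑ k, ∑ δ, ∑ l, wedge₃ (Δ β γ δ α k l) (wedge₂ (θ γ k) (θ δ l))
      + (2 : ℝ) • ∑ γ, ∑ k, ∑ δ, ∑ l, b β γ δ α k l • wedge₃ (θ δ l) (A γ k)) := by
  have hBφ : ∑ γ, (wedge₃ (φ γ β) (B α γ) - wedge₃ (φ α γ) (B γ β))
      = ∑ γ, ∑ k, ∑ δ, ∑ l, wedge₃ (∑ ε, b ε γ δ α k l • φ ε β - ∑ ε, b β γ δ ε k l • φ α ε)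
          (wedge₂ (θ γ k) (θ δ l)) := by
    have e : ∀ f : Fin p → Fin p → Fin q → Fin p → Fin q → E → E → E → ℝ,
        ∑ γ, ∑ k, ∑ δ, ∑ l, ∑ ε, f ε γ k δ l = ∑ ε, ∑ γ, ∑ k, ∑ δ, ∑ l, f ε γ k δ l := fun f => by
      have h := Finset.sum_comm (s := (Finset.univ : Finset (Fin p × Fin q × Fin p × Fin q)))
        (t := (Finset.univ : Finset (Fin p))) (f := fun s m => f m s.1 s.2.1 s.2.2.1 s.2.2.2)
      simpa only [Fintype.sum_prod_type] using h
    simp only [hB, map_sum, map_sub, map_smul, LinearMap.sub_apply, LinearMap.sum_apply,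
      LinearMap.smul_apply, Finset.sum_sub_distrib, e]
  rw [sum_wedge₃_dφ hφ, sum_wedge₃_dθ_dπ hθ hπ, hBφ] at closed
  simp only [Finset.sum_add_distrib] at closed
  rw [sum_smul_wedge₃_dθ hθ (hb β · · α · ·)] at closed
  have hπ' := sum_wedge₃_π (K := K) (π := π) hA α β
  -- Δ splits into db, the action on the outer indices α, β (from φ ∧ B), the action on the two
  -- pairs together with τ (from b dθ), and the correction in π.
  have hΔ' : ∑ γ, ∑ k, ∑ δ, ∑ l, wedge₃ (Δ β γ δ α k l) (wedge₂ (θ γ k) (θ δ l))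
      = ∑ γ, ∑ k, ∑ δ, ∑ l, wedge₃ (db β γ δ α k l) (wedge₂ (θ γ k) (θ δ l))
      + ∑ γ, ∑ k, ∑ δ, ∑ l, wedge₃ (∑ ε, b ε γ δ α k l • φ ε β - ∑ ε, b β γ δ ε k l • φ α ε)
          (wedge₂ (θ γ k) (θ δ l))
      + ∑ γ, ∑ k, ∑ δ, ∑ l, wedge₃ (- ∑ m, b β γ δ α m l • ψ k m - ∑ m, b β γ δ α k m • ψ l m
        + ∑ ε, b β ε δ α k l • φ ε γ + ∑ ε, b β γ ε α k l • φ ε δ + (2 * b β γ δ α k l) • τ)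
          (wedge₂ (θ γ k) (θ δ l))
      - ∑ γ, ∑ k, ∑ δ, ∑ l, wedge₃ ((K / 2) • ∑ m, ∑ ε, (2 * kron ε β * a m γ δ α k l
        - kron α γ * a m β δ ε k l + kron α δ * a m β γ ε l k) • π m ε)
          (wedge₂ (θ γ k) (θ δ l)) := by
    simp only [← Finset.sum_add_distrib, ← Finset.sum_sub_distrib, ← LinearMap.add_apply,
      ← LinearMap.sub_apply, ← map_add, ← map_sub]
    refine Finset.sum_congr rfl fun γ _ => Finset.sum_congr rfl fun k _ =>
      Finset.sum_congr rfl fun δ _ => Finset.sum_congr rfl fun l _ => ?_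
    rw [hΔ]
    congr 2
    simp only [Finset.sum_sub_distrib]
    abel
  rw [hΔ', hπ']
  refine eq_neg_of_add_eq_zero_left ?_
  rw [← closed]
  module

end BianchiAlgebra

/-! ### The Bianchi identity for fields of forms, and its value on frame vectors. -/

section Bianchi

variable {E : Type*} [NormedAddCommGroup E] [NormedSpace ℝ E] {p q : ℕ}
  {θ : Fin p → Fin q → E → E →L[ℝ] ℝ} {φ : Fin p → Fin p → E → E →L[ℝ] ℝ}
  {ψ : Fin q → Fin q → E → E →L[ℝ] ℝ} {τ : E → E →L[ℝ] ℝ} {π : Fin q → Fin p → E → E →L[ℝ] ℝ}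
  {b : Fin p → Fin p → Fin p → Fin p → Fin q → Fin q → E → ℝ}
  {K K' : ℝ} {y : E}

/-- Both sides of the structure equation are differentiated, using ddφ = 0 and ddτ = 0. The equation
is needed on a neighbourhood because b is differentiated too. -/
theorem closed_of_structure_equation
    (dθ : ∀ α i, DifferentiableAt ℝ (θ α i) y) (dφ : ∀ α β, ContDiffAt ℝ 2 (φ α β) y)
    (dτ : ContDiffAt ℝ 2 τ y) (dπ : ∀ i α, DifferentiableAt ℝ (π i α) y)
    (db : ∀ β γ δ α k l, DifferentiableAt ℝ (b β γ δ α k l) y)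
    (hφ : ∀ᶠ z in 𝓝 y, ∀ α β, dOne (φ α β) z = ∑ γ, wedge₂ (φ α γ z) (φ γ β z)
      - (K' * kron α β) • dOne τ z - K • ∑ k, wedge₂ (θ α k z) (π k β z)
      + ∑ γ, ∑ k, ∑ δ, ∑ l, b β γ δ α k l z • wedge₂ (θ γ k z) (θ δ l z)) (α β : Fin p) :
    ∑ γ, (wedge₃ (φ γ β y) (dOne (φ α γ) y) - wedge₃ (φ α γ y) (dOne (φ γ β) y))
      - K • ∑ k, (wedge₃ (π k β y) (dOne (θ α k) y) - wedge₃ (θ α k y) (dOne (π k β) y))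
      + ∑ γ, ∑ k, ∑ δ, ∑ l,
        (wedge₃ (fderiv ℝ (b β γ δ α k l) y) (wedge₂ (θ γ k y) (θ δ l y))
        + b β γ δ α k l y • (wedge₃ (θ δ l y) (dOne (θ γ k) y)
          - wedge₃ (θ γ k y) (dOne (θ δ l) y))) = 0 := by
  have dφ' := fun α β => (dφ α β).differentiableAt (by norm_num)
  have h1 := ((((HasExtDeriv.sum Finset.univ fun γ => .wedge (dφ' α γ) (dφ' γ β)).sub
    ((HasExtDeriv.dOne dτ).const_smul (K' * kron α β))).sub
    ((HasExtDeriv.sum Finset.univ fun k => .wedge (dθ α k) (dπ k β)).const_smul K)).add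
    (.sum Finset.univ fun γ => .sum Finset.univ fun k => .sum Finset.univ fun δ =>
      .sum Finset.univ fun l => .smul (db β γ δ α k l) (.wedge (dθ γ k) (dθ δ l))))
  have h2 := h1.unique (HasExtDeriv.dOne (dφ α β)) (hφ.mono fun z hz => (hz α β).symm)
  simpa only [smul_zero, sub_zero] using h2

theorem sum_mul_wedge₂_apply {θ : Fin p → Fin q → E →L[ℝ] ℝ} {e : Fin q → Fin p → E}
    (he : ∀ α i j β, θ α i (e j β) = kron α β * kron i j)
    (b : Fin p → Fin p → Fin q → Fin q → ℝ) (γ δ : Fin p) (k l : Fin q) :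
    ∑ γ', ∑ k', ∑ δ', ∑ l', b γ' δ' k' l' * wedge₂ (θ γ' k') (θ δ' l') (e k γ) (e l δ)
      = b γ δ k l - b δ γ l k := by
  simp [wedge₂, he, kron, mul_sub, Finset.sum_sub_distrib]

/-- The components of the curvature `C` of the forms `π` in terms of the components of the torsion,
of the curvature of the forms `φ`, and of the Pfaffian form `Δ` of the latter. -/
theorem curvature_apply {e : Fin q → Fin p → E}
    {A : Fin p → Fin q → E → E → ℝ} {C : Fin q → Fin p → E → E → ℝ}
    {a : Fin q → Fin p → Fin p → Fin p → Fin q → Fin q → ℝ}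
    {Δ : Fin p → Fin p → Fin p → Fin p → Fin q → Fin q → E →L[ℝ] ℝ}
    (dθ : ∀ α i, DifferentiableAt ℝ (θ α i) y) (dφ : ∀ α β, ContDiffAt ℝ 2 (φ α β) y)
    (dτ : ContDiffAt ℝ 2 τ y) (dπ : ∀ i α, DifferentiableAt ℝ (π i α) y)
    (db : ∀ β γ δ α k l, DifferentiableAt ℝ (b β γ δ α k l) y)
    (hφ : ∀ᶠ z in 𝓝 y, ∀ α β, dOne (φ α β) z = ∑ γ, wedge₂ (φ α γ z) (φ γ β z)
      - (K' * kron α β) • dOne τ z - K • ∑ k, wedge₂ (θ α k z) (π k β z)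
      + ∑ γ, ∑ k, ∑ δ, ∑ l, b β γ δ α k l z • wedge₂ (θ γ k z) (θ δ l z))
    (hθ : ∀ α i, dOne (θ α i) y = ∑ j, wedge₂ (θ α j y) (ψ j i y)
      + ∑ β, wedge₂ (φ α β y) (θ β i y) + wedge₂ (τ y) (θ α i y) + A α i)
    (hπ : ∀ i α, dOne (π i α) y = ∑ β, wedge₂ (π i β y) (φ β α y)
      + ∑ j, wedge₂ (ψ i j y) (π j α y) - wedge₂ (τ y) (π i α y)
      - ∑ k, ∑ γ, ∑ β, ∑ j, a k α β γ i j • wedge₂ (π k γ y) (θ β j y) + C i α)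
    (hA : ∀ α i, A α i = ∑ β, ∑ j, ∑ γ, ∑ k, a i β γ α j k • wedge₂ (θ β j y) (θ γ k y))
    (ha : ∀ i β γ α j k, a i β γ α j k = -a i γ β α k j)
    (hb : ∀ β γ δ α k l, b β γ δ α k l y = -b β δ γ α l k y)
    (hΔ : ∀ β γ δ α k l, Δ β γ δ α k l = fderiv ℝ (b β γ δ α k l) y
      - ∑ ε, b β γ δ ε k l y • φ α ε y - ∑ m, b β γ δ α m l y • ψ k m y
      - ∑ m, b β γ δ α k m y • ψ l m y + ∑ ε, b ε γ δ α k l y • φ ε β y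
      + ∑ ε, b β ε δ α k l y • φ ε γ y + ∑ ε, b β γ ε α k l y • φ ε δ y
      + (2 * b β γ δ α k l y) • τ y
      - (K / 2) • ∑ m, ∑ ε, (2 * kron ε β * a m γ δ α k l - kron α γ * a m β δ ε k l
          + kron α δ * a m β γ ε l k) • π m ε y)
    (he : ∀ α i j β, θ α i y (e j β) = kron α β * kron i j)
    {α γ δ : Fin p} (hγ : α ≠ γ) (hδ : α ≠ δ) (β : Fin p) (i k l : Fin q) :
    K * C i β (e k γ) (e l δ) =
      -(Δ β γ δ α k l (e i α) - Δ β δ γ α l k (e i α)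
      + Δ β δ α α l i (e k γ) - Δ β α δ α i l (e k γ)
      + Δ β α γ α i k (e l δ) - Δ β γ α α k i (e l δ)
      + 4 * ∑ ε, ∑ m, (b β ε α α m i y * a m γ δ ε k l + b β ε γ α m k y * a m δ α ε l i
        + b β ε δ α m l y * a m α γ ε i k)) := by
  have h := sum_wedge₃_curvature hθ hφ.self_of_nhds hπ hA (fun _ _ => rfl) hb hΔ α β
    (closed_of_structure_equation dθ dφ dτ dπ db hφ α β)
  have h' := congrFun (congrFun₂ h (e i α) (e k γ)) (e l δ)
  -- A skew component is counted twice in a sum over ordered pairs. Together with the 2 already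
  -- before the torsion term this gives the 4 in the conclusion.
  have hA' : ∀ α i β γ j k, A α i (e j β) (e k γ) = 2 * a i β γ α j k := fun α i β γ j k => by
    have h := sum_mul_wedge₂_apply he (fun β γ j k => a i β γ α j k) β γ j k
    rw [hA]
    simp only [Finset.sum_apply, Pi.smul_apply, smul_eq_mul, h]
    rw [ha i γ]
    ring
  simp only [Pi.smul_apply, Pi.neg_apply, Pi.add_apply, Finset.sum_apply, wedge₃_apply,
    smul_eq_mul, Finset.sum_add_distrib, mul_add, hA',
    sum_mul_wedge₂_apply he fun γ' δ' k' l' => Δ β γ' δ' α k' l' (e i α),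
    sum_mul_wedge₂_apply he fun γ' δ' k' l' => Δ β γ' δ' α k' l' (e k γ),
    sum_mul_wedge₂_apply he fun γ' δ' k' l' => Δ β γ' δ' α k' l' (e l δ)] at h'
  -- As α differs from γ and δ, the forms θ_α^k vanish on the last two vectors, and one term of the
  -- left side survives.
  simp only [he, kron, if_neg hγ, if_neg hδ] at h'
  simp at h'
  rw [h']
  simp only [mul_left_comm _ (2 : ℝ), ← Finset.mul_sum, Finset.sum_add_distrib]
  ring

end Bianchi

/-! ### Signs and reorderings for the exchange of Greek and Latin indices. -/

section Transpose

variable {E : Type*} [NormedAddCommGroup E] [NormedSpace ℝ E]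

theorem wedge₂_neg_left (μ ν : E →L[ℝ] ℝ) : wedge₂ (-μ) ν = -wedge₂ μ ν := by
  ext u v; simp [wedge₂]; ring

theorem wedge₂_neg_right (μ ν : E →L[ℝ] ℝ) : wedge₂ μ (-ν) = -wedge₂ μ ν := by
  rw [wedge₂_swap, wedge₂_neg_left, ← wedge₂_swap]

theorem dOne_neg (μ : E → E →L[ℝ] ℝ) (x : E) : dOne (fun z => -μ z) x = -dOne μ x := by
  ext u v
  have : fderiv ℝ (fun z => -μ z) x = -fderiv ℝ μ x := fderiv_neg
  simp only [dOne, this, neg_apply, Pi.neg_apply]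
  ring

theorem kron_comm {n : ℕ} (a b : Fin n) : kron a b = kron b a := by
  simp [kron, eq_comm]

theorem sum_pair_comm {ι κ ι' κ' V : Type*} [Fintype ι] [Fintype κ] [Fintype ι'] [Fintype κ']
    [AddCommMonoid V] (f : ι → κ → ι' → κ' → V) :
    ∑ γ, ∑ k, ∑ δ, ∑ l, f γ k δ l = ∑ k, ∑ γ, ∑ l, ∑ δ, f γ k δ l := by
  rw [Finset.sum_comm]
  exact Finset.sum_congr rfl fun _ _ => Finset.sum_congr rfl fun _ _ => Finset.sum_comm

end Transpose

/-! ### The exterior differential on the coordinate space. -/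

section Coordinates

variable {p q : ℕ}

theorem wedge_eq_wedge₂ (μ ν : Model p q →L[ℝ] ℝ) : wedge μ ν = wedge₂ μ ν := rfl

/-- `extDeriv` is alternating whether or not μ is differentiable, so the skew symmetry of a and b
will hold at every point. -/
theorem extD_mem_skewForms (μ : OneForm p q) (x : Model p q) :
    extD μ x ∈ skewForms (Model p q) := by
  refine ⟨fun v => ⟨fun u w => ?_, fun c u => ?_⟩, fun u v => ?_⟩
  · exact ContinuousAlternatingMap.vecCons_add _ ![v] u w
  · exact ContinuousAlternatingMap.vecCons_smul _ ![v] c u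
  · have h := (extDeriv (fun z => ContinuousAlternatingMap.ofSubsingleton ℝ (Model p q) ℝ
      (0 : Fin 1) (μ z)) x).toAlternatingMap.map_swap ![v, u] (i := 0) (j := 1) (by simp)
    have e : ![v, u] ∘ Equiv.swap (0 : Fin 2) 1 = ![u, v] := by
      ext i; fin_cases i <;> simp
    rw [e] at h
    exact h

theorem extD_eq_dOne {μ : OneForm p q} {x : Model p q} (hμ : DifferentiableAt ℝ μ x) :
    extD μ x = dOne μ x := by
  ext u v
  have h : DifferentiableAt ℝ (fun z => ContinuousAlternatingMap.ofSubsingleton ℝ (Model p q) ℝ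
      (0 : Fin 1) (μ z)) x :=
    (ContinuousAlternatingMap.ofSubsingletonLIE (𝕜 := ℝ) (E := Model p q) (F := ℝ)
      (0 : Fin 1)).differentiable.differentiableAt.comp x hμ
  have h' := fun w => fderiv_clm_apply hμ (differentiableAt_const w)
  rw [extD, extDeriv_apply h]
  simp [Fin.sum_univ_two, h', dOne, Fin.removeNth, sub_eq_add_neg]

end Coordinates

/-! ### Structure equations of a reduced moving frame and the formulas for c. -/

namespace MovingFrame

variable {p q : ℕ} (F : MovingFrame p q)

theorem torsionForm_eq (α : Fin p) (i : Fin q) (x : Model p q) :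
    F.torsionForm α i x = extD (F.cof α i) x - ∑ j, wedge₂ (F.cof α j x) (F.la j i x)
      - ∑ β, wedge₂ (F.gr α β x) (F.cof β i x) - wedge₂ (F.sc x) (F.cof α i x) := by
  ext u v
  simp [torsionForm, wedge_eq_wedge₂]

theorem curvFormGr_eq (α β : Fin p) (x : Model p q) :
    F.curvFormGr α β x = extD (F.gr α β) x - ∑ γ, wedge₂ (F.gr α γ x) (F.gr γ β x)
      - ((q : ℝ) / (p + q)) • (kron α β • ∑ γ, ∑ k, wedge₂ (F.cof γ k x) (F.pr k γ x)
        - (p : ℝ) • ∑ k, wedge₂ (F.cof α k x) (F.pr k β x)) := by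
  ext u v
  simp [curvFormGr, wedge_eq_wedge₂]

theorem curvFormLa_eq (j i : Fin q) (x : Model p q) :
    F.curvFormLa j i x = extD (F.la j i) x - ∑ k, wedge₂ (F.la j k x) (F.la k i x)
      - ((p : ℝ) / (p + q)) • (kron j i • ∑ k, ∑ γ, wedge₂ (F.pr k γ x) (F.cof γ k x)
        - (q : ℝ) • ∑ γ, wedge₂ (F.pr j γ x) (F.cof γ i x)) := by
  ext u v
  simp [curvFormLa, wedge_eq_wedge₂]

theorem curvFormPr_eq (i : Fin q) (α : Fin p) (x : Model p q) :
    F.curvFormPr i α x = extD (F.pr i α) x - ∑ β, wedge₂ (F.pr i β x) (F.gr β α x)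
      - ∑ j, wedge₂ (F.la i j x) (F.pr j α x) + wedge₂ (F.sc x) (F.pr i α x)
      + ∑ k, ∑ γ, ∑ β, ∑ j, F.a k α β γ i j x • wedge₂ (F.pr k γ x) (F.cof β j x) := by
  ext u v
  simp [curvFormPr, wedge_eq_wedge₂]

theorem torsionForm_mem_skewForms (α : Fin p) (i : Fin q) (x : Model p q) :
    F.torsionForm α i x ∈ skewForms (Model p q) := by
  rw [torsionForm_eq]
  exact sub_mem (sub_mem (sub_mem (extD_mem_skewForms _ _)
    (sum_mem fun _ _ => wedge₂_mem_skewForms _ _)) (sum_mem fun _ _ => wedge₂_mem_skewForms _ _))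
    (wedge₂_mem_skewForms _ _)

theorem curvFormGr_mem_skewForms (α β : Fin p) (x : Model p q) :
    F.curvFormGr α β x ∈ skewForms (Model p q) := by
  rw [curvFormGr_eq]
  exact sub_mem (sub_mem (extD_mem_skewForms _ _) (sum_mem fun _ _ => wedge₂_mem_skewForms _ _))
    (Submodule.smul_mem _ _ (sub_mem (Submodule.smul_mem _ _ (sum_mem fun _ _ =>
      sum_mem fun _ _ => wedge₂_mem_skewForms _ _))
      (Submodule.smul_mem _ _ (sum_mem fun _ _ => wedge₂_mem_skewForms _ _))))

theorem curvFormLa_mem_skewForms (j i : Fin q) (x : Model p q) :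
    F.curvFormLa j i x ∈ skewForms (Model p q) := by
  rw [curvFormLa_eq]
  exact sub_mem (sub_mem (extD_mem_skewForms _ _) (sum_mem fun _ _ => wedge₂_mem_skewForms _ _))
    (Submodule.smul_mem _ _ (sub_mem (Submodule.smul_mem _ _ (sum_mem fun _ _ =>
      sum_mem fun _ _ => wedge₂_mem_skewForms _ _))
      (Submodule.smul_mem _ _ (sum_mem fun _ _ => wedge₂_mem_skewForms _ _))))

theorem a_swap (i : Fin q) (β γ α : Fin p) (j k : Fin q) (x : Model p q) :
    F.a i β γ α j k x = -F.a i γ β α k j x := by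
  rw [a, a, (F.torsionForm_mem_skewForms α i x).2]
  ring

theorem bGr_swap (β γ δ α : Fin p) (k l : Fin q) (x : Model p q) :
    F.bGr β γ δ α k l x = -F.bGr β δ γ α l k x := by
  rw [bGr, bGr, (F.curvFormGr_mem_skewForms α β x).2]
  ring

theorem bLa_swap (i : Fin q) (γ δ : Fin p) (j k l : Fin q) (x : Model p q) :
    F.bLa i γ δ j k l x = -F.bLa i δ γ j l k x := by
  rw [bLa, bLa, (F.curvFormLa_mem_skewForms j i x).2]
  ring

variable {F} {M : Type*} [TopologicalSpace M] [ChartedSpace (Model p q) M]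
  {S : AlmostGrassmannStructure p q M} {e : OpenPartialHomeomorph M (Model p q)}

namespace IsReduced

variable {y : Model p q}

theorem contDiffAt_cof (hF : F.IsReduced S e) (hy : y ∈ e.target) (α : Fin p) (i : Fin q) :
    ContDiffAt ℝ ∞ (F.cof α i) y :=
  (hF.adapted.1 α i).contDiffAt (e.open_target.mem_nhds hy)

theorem contDiffAt_vec (hF : F.IsReduced S e) (hy : y ∈ e.target) (i : Fin q) (α : Fin p) :
    ContDiffAt ℝ ∞ (F.vec i α) y :=
  (hF.smooth_vec i α).contDiffAt (e.open_target.mem_nhds hy)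

theorem contDiffAt_gr (hF : F.IsReduced S e) (hy : y ∈ e.target) (α β : Fin p) :
    ContDiffAt ℝ ∞ (F.gr α β) y :=
  (hF.smooth_gr α β).contDiffAt (e.open_target.mem_nhds hy)

theorem contDiffAt_la (hF : F.IsReduced S e) (hy : y ∈ e.target) (j i : Fin q) :
    ContDiffAt ℝ ∞ (F.la j i) y :=
  (hF.smooth_la j i).contDiffAt (e.open_target.mem_nhds hy)

theorem contDiffAt_sc (hF : F.IsReduced S e) (hy : y ∈ e.target) : ContDiffAt ℝ ∞ F.sc y :=
  hF.smooth_sc.contDiffAt (e.open_target.mem_nhds hy)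

theorem contDiffAt_pr (hF : F.IsReduced S e) (hy : y ∈ e.target) (i : Fin q) (α : Fin p) :
    ContDiffAt ℝ ∞ (F.pr i α) y :=
  (hF.smooth_pr i α).contDiffAt (e.open_target.mem_nhds hy)

/-- Duality makes the frame vectors independent; there are pq of them in dimension pq, so they span.
-/
theorem eq_sum_cof_smul_vec (hF : F.IsReduced S e) (hy : y ∈ e.target) (v : Model p q) :
    v = ∑ s : Fin p × Fin q, F.cof s.1 s.2 y v • F.vec s.2 s.1 y := by
  have hdual : ∀ (c : Fin p × Fin q → ℝ) (t : Fin p × Fin q),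
      F.cof t.1 t.2 y (∑ s, c s • F.vec s.2 s.1 y) = c t := fun c t => by
    simp [hF.dual y hy, kron, Fintype.sum_prod_type]
  have hli : LinearIndependent ℝ fun s : Fin p × Fin q => F.vec s.2 s.1 y := by
    rw [Fintype.linearIndependent_iff]
    intro c hc t
    rw [← hdual c t, hc, map_zero]
  have hspan := hli.span_eq_top_of_card_eq_finrank' (by simp)
  have hv : v ∈ Submodule.span ℝ (Set.range fun s : Fin p × Fin q => F.vec s.2 s.1 y) :=
    hspan ▸ Submodule.mem_top
  obtain ⟨c, rfl⟩ := (Submodule.mem_span_range_iff_exists_fun ℝ).1 hv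
  simp only [hdual]

theorem eq_sum_wedge₂ (hF : F.IsReduced S e) (hy : y ∈ e.target)
    {G : Model p q → Model p q → ℝ} (hG : G ∈ skewForms (Model p q)) :
    G = ∑ γ, ∑ k, ∑ δ, ∑ l, ((1 / 2) * G (F.vec k γ y) (F.vec l δ y)) •
      wedge₂ (F.cof γ k y) (F.cof δ l y) := by
  have h := eq_sum_wedge₂_of_mem_skewForms (e := fun s : Fin p × Fin q => F.vec s.2 s.1 y)
    (θ := fun s => F.cof s.1 s.2 y) (hF.eq_sum_cof_smul_vec hy) hG
  simpa only [Fintype.sum_prod_type] using h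

theorem dOne_sc (hF : F.IsReduced S e) (hy : y ∈ e.target) :
    dOne F.sc y = ∑ i, ∑ α, wedge₂ (F.pr i α y) (F.cof α i y) := by
  rw [← extD_eq_dOne ((hF.contDiffAt_sc hy).differentiableAt (by simp))]
  ext u v
  simp [hF.d_sc y hy, wedge_eq_wedge₂]

theorem dOne_cof (hF : F.IsReduced S e) (hy : y ∈ e.target) (α : Fin p) (i : Fin q) :
    dOne (F.cof α i) y = ∑ j, wedge₂ (F.cof α j y) (F.la j i y)
      + ∑ β, wedge₂ (F.gr α β y) (F.cof β i y) + wedge₂ (F.sc y) (F.cof α i y)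
      + F.torsionForm α i y := by
  rw [torsionForm_eq, extD_eq_dOne ((hF.contDiffAt_cof hy α i).differentiableAt (by simp))]
  abel

/-- Since ω_γ^k ∧ ω_k^γ = -dω, the trace term is a constant multiple of dω and disappears under a
further differentiation. -/
theorem dOne_gr (hF : F.IsReduced S e) (hy : y ∈ e.target) (α β : Fin p) :
    dOne (F.gr α β) y = ∑ γ, wedge₂ (F.gr α γ y) (F.gr γ β y)
      - ((q : ℝ) / (p + q) * kron α β) • dOne F.sc y
      - ((p * q : ℝ) / (p + q)) • ∑ k, wedge₂ (F.cof α k y) (F.pr k β y)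
      + ∑ γ, ∑ k, ∑ δ, ∑ l, F.bGr β γ δ α k l y • wedge₂ (F.cof γ k y) (F.cof δ l y) := by
  have h := hF.eq_sum_wedge₂ hy (F.curvFormGr_mem_skewForms α β y)
  have hs : ∑ γ, ∑ k, wedge₂ (F.cof γ k y) (F.pr k γ y) = -dOne F.sc y := by
    rw [hF.dOne_sc hy, Finset.sum_comm]
    simp only [← Finset.sum_neg_distrib, ← wedge₂_swap]
  simp only [bGr]
  rw [← h, curvFormGr_eq, hs, extD_eq_dOne ((hF.contDiffAt_gr hy α β).differentiableAt (by simp))]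
  module

theorem dOne_la (hF : F.IsReduced S e) (hy : y ∈ e.target) (j i : Fin q) :
    dOne (F.la j i) y = ∑ k, wedge₂ (F.la j k y) (F.la k i y)
      + ((p : ℝ) / (p + q) * kron j i) • dOne F.sc y
      - ((p * q : ℝ) / (p + q)) • ∑ γ, wedge₂ (F.pr j γ y) (F.cof γ i y)
      + ∑ γ, ∑ k, ∑ δ, ∑ l, F.bLa i γ δ j k l y • wedge₂ (F.cof γ k y) (F.cof δ l y) := by
  have h := hF.eq_sum_wedge₂ hy (F.curvFormLa_mem_skewForms j i y)
  simp only [bLa]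
  rw [← h, curvFormLa_eq, ← hF.dOne_sc hy,
    extD_eq_dOne ((hF.contDiffAt_la hy j i).differentiableAt (by simp))]
  module

theorem dOne_pr (hF : F.IsReduced S e) (hy : y ∈ e.target) (i : Fin q) (α : Fin p) :
    dOne (F.pr i α) y = ∑ β, wedge₂ (F.pr i β y) (F.gr β α y)
      + ∑ j, wedge₂ (F.la i j y) (F.pr j α y) - wedge₂ (F.sc y) (F.pr i α y)
      - ∑ k, ∑ γ, ∑ β, ∑ j, F.a k α β γ i j y • wedge₂ (F.pr k γ y) (F.cof β j y)
      + F.curvFormPr i α y := by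
  rw [curvFormPr_eq, extD_eq_dOne ((hF.contDiffAt_pr hy i α).differentiableAt (by simp))]
  abel

/-- The components of b contain first derivatives of the forms, so their differentiability rests on
second derivatives of these forms. -/
theorem differentiableAt_extD_vec (hF : F.IsReduced S e) (hy : y ∈ e.target) {μ : OneForm p q}
    (hμ : ContDiffOn ℝ ∞ μ e.target) (k l : Fin q) (γ δ : Fin p) :
    DifferentiableAt ℝ (fun z => extD μ z (F.vec k γ z) (F.vec l δ z)) y := by
  have hμ' : ∀ z ∈ e.target, ContDiffAt ℝ ∞ μ z := fun z hz =>
    hμ.contDiffAt (e.open_target.mem_nhds hz)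
  have hd : DifferentiableAt ℝ (fderiv ℝ μ) y :=
    (((hμ' y hy).of_le (WithTop.coe_le_coe.2 le_top : 2 ≤ ∞)).fderiv_right (m := 1)
      (by norm_num)).differentiableAt (by norm_num)
  have hk := (hF.contDiffAt_vec hy k γ).differentiableAt (by simp)
  have hl := (hF.contDiffAt_vec hy l δ).differentiableAt (by simp)
  refine (((hd.clm_apply hk).clm_apply hl).sub
    ((hd.clm_apply hl).clm_apply hk)).congr_of_eventuallyEq ?_
  filter_upwards [e.open_target.mem_nhds hy] with z hz
  rw [extD_eq_dOne ((hμ' z hz).differentiableAt (by simp))]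
  rfl

theorem differentiableAt_wedge_vec (hF : F.IsReduced S e) (hy : y ∈ e.target)
    {μ ν : OneForm p q} (hμ : ContDiffAt ℝ ∞ μ y) (hν : ContDiffAt ℝ ∞ ν y) (k l : Fin q)
    (γ δ : Fin p) :
    DifferentiableAt ℝ (fun z => wedge (μ z) (ν z) (F.vec k γ z) (F.vec l δ z)) y := by
  have hk := (hF.contDiffAt_vec hy k γ).differentiableAt (by simp)
  have hl := (hF.contDiffAt_vec hy l δ).differentiableAt (by simp)
  have hμ' := hμ.differentiableAt (by simp)
  have hν' := hν.differentiableAt (by simp)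
  exact ((hμ'.clm_apply hk).mul (hν'.clm_apply hl)).sub ((hμ'.clm_apply hl).mul (hν'.clm_apply hk))

theorem differentiableAt_bGr (hF : F.IsReduced S e) (hy : y ∈ e.target)
    (β γ δ α : Fin p) (k l : Fin q) : DifferentiableAt ℝ (F.bGr β γ δ α k l) y := by
  refine (((hF.differentiableAt_extD_vec hy (hF.smooth_gr α β) k l γ δ).sub
    (.fun_sum fun ε _ => hF.differentiableAt_wedge_vec hy (hF.contDiffAt_gr hy α ε)
      (hF.contDiffAt_gr hy ε β) k l γ δ)).sub (.const_mul (.sub (.const_mul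
    (.fun_sum fun ε _ => .fun_sum fun m _ => hF.differentiableAt_wedge_vec hy
      (hF.contDiffAt_cof hy ε m) (hF.contDiffAt_pr hy m ε) k l γ δ) _) (.const_mul
    (.fun_sum fun m _ => hF.differentiableAt_wedge_vec hy
      (hF.contDiffAt_cof hy α m) (hF.contDiffAt_pr hy m β) k l γ δ) _)) _)).const_mul _

theorem differentiableAt_bLa (hF : F.IsReduced S e) (hy : y ∈ e.target)
    (i : Fin q) (γ δ : Fin p) (j k l : Fin q) : DifferentiableAt ℝ (F.bLa i γ δ j k l) y := by
  refine (((hF.differentiableAt_extD_vec hy (hF.smooth_la j i) k l γ δ).sub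
    (.fun_sum fun m _ => hF.differentiableAt_wedge_vec hy (hF.contDiffAt_la hy j m)
      (hF.contDiffAt_la hy m i) k l γ δ)).sub (.const_mul (.sub (.const_mul
    (.fun_sum fun m _ => .fun_sum fun ε _ => hF.differentiableAt_wedge_vec hy
      (hF.contDiffAt_pr hy m ε) (hF.contDiffAt_cof hy ε m) k l γ δ) _) (.const_mul
    (.fun_sum fun ε _ => hF.differentiableAt_wedge_vec hy
      (hF.contDiffAt_pr hy j ε) (hF.contDiffAt_cof hy ε i) k l γ δ) _)) _)).const_mul _

/-- The components of the curvature of the forms `ω_i^α` in terms of the torsion, of the curvature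
of the forms `ω_α^β`, and of the Pfaffian derivatives of the latter. -/
theorem mul_c_eq_gr (hF : F.IsReduced S e) (hy : y ∈ e.target) {η β γ : Fin p} (hβ : η ≠ β)
    (hγ : η ≠ γ) (α : Fin p) (i j k : Fin q) :
    (p * q : ℝ) / (p + q) * (2 * F.c α β γ i j k y) =
      -(F.bGrD α γ β η η k j i y - F.bGrD α β γ η η j k i y
      + F.bGrD α β η γ η j i k y - F.bGrD α η β γ η i j k y
      + F.bGrD α η γ β η i k j y - F.bGrD α γ η β η k i j y
      + 4 * ∑ ε, ∑ m, (F.bGr α ε η η m i y * F.a m γ β ε k j y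
        + F.bGr α ε γ η m k y * F.a m β η ε j i y
        + F.bGr α ε β η m j y * F.a m η γ ε i k y)) := by
  -- The expansion of the curvature is in ω_γ^k ∧ ω_β^j, so the vector with indices (k, γ) comes
  -- first.
  have hc : 2 * F.c α β γ i j k y = F.curvFormPr i α y (F.vec k γ y) (F.vec j β y) := by
    rw [c]; ring
  rw [hc]
  refine curvature_apply (θ := F.cof) (φ := F.gr) (ψ := F.la) (τ := F.sc) (π := F.pr)
    (b := F.bGr) (K' := q / (p + q)) (e := fun i α => F.vec i α y)
    (A := fun α i => F.torsionForm α i y) (C := fun i α => F.curvFormPr i α y)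
    (a := fun i β γ α j k => F.a i β γ α j k y)
    (Δ := fun β γ δ α k l => F.deltaBGr β γ δ α k l y)
    (fun α i => (hF.contDiffAt_cof hy α i).differentiableAt (by simp))
    (fun α β => (hF.contDiffAt_gr hy α β).of_le (WithTop.coe_le_coe.2 le_top))
    ((hF.contDiffAt_sc hy).of_le (WithTop.coe_le_coe.2 le_top))
    (fun i α => (hF.contDiffAt_pr hy i α).differentiableAt (by simp))
    (hF.differentiableAt_bGr hy) ?_ (hF.dOne_cof hy) (hF.dOne_pr hy)
    (fun α i => hF.eq_sum_wedge₂ hy (F.torsionForm_mem_skewForms α i y))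
    (fun i β γ α j k => F.a_swap i β γ α j k y) (fun β γ δ α k l => F.bGr_swap β γ δ α k l y)
    ?_ (hF.dual y hy) hγ hβ α i k j
  · filter_upwards [e.open_target.mem_nhds hy] with z hz using hF.dOne_gr hz
  · intro β γ δ α k l
    simp only [deltaBGr, div_div, mul_comm (2 : ℝ) (p + q)]

/-- The components of the curvature of the forms `ω_i^α` in terms of the torsion, of the curvature
of the forms `ω_j^i`, and of the Pfaffian derivatives of the latter. -/
theorem mul_c_eq_la (hF : F.IsReduced S e) (hy : y ∈ e.target) {n j k : Fin q} (hj : n ≠ j)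
    (hk : n ≠ k) (α β γ : Fin p) (i : Fin q) :
    (p * q : ℝ) / (p + q) * (2 * F.c α β γ i j k y) =
      F.bLaD n γ β α i k j n y - F.bLaD n β γ α i j k n y
      + F.bLaD n β α γ i j n k y - F.bLaD n α β γ i n j k y
      + F.bLaD n α γ β i n k j y - F.bLaD n γ α β i k n j y
      + 4 * ∑ m, ∑ ε, (F.bLa n ε α i m n y * F.a m γ β ε k j y
        + F.bLa n ε γ i m k y * F.a m β α ε j n y
        + F.bLa n ε β i m j y * F.a m α γ ε n k y) := by
  have hc : 2 * F.c α β γ i j k y = F.curvFormPr i α y (F.vec k γ y) (F.vec j β y) := by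
    rw [c]; ring
  rw [hc]
  -- Transposition reverses the order in products of matrices of 1-forms, and the minus sign
  -- restores it. K is symmetric in p and q; b and Δ change sign along with ω_j^i, which also
  -- matches the opposite sign of the correction term in Δ.
  have h := curvature_apply (θ := fun i α => F.cof α i) (φ := fun i j z => -F.la j i z)
    (ψ := fun α β z => -F.gr β α z) (τ := F.sc) (π := fun α i => F.pr i α)
    (b := fun j k l i γ δ z => -F.bLa i γ δ j k l z) (K := (p * q : ℝ) / (p + q))
    (K' := p / (p + q)) (e := fun α i => F.vec i α y)
    (A := fun i α => F.torsionForm α i y) (C := fun α i => F.curvFormPr i α y)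
    (a := fun α j k i β γ => F.a i β γ α j k y)
    (Δ := fun j k l i γ δ => -F.deltaBLa i γ δ j k l y)
    (fun i α => (hF.contDiffAt_cof hy α i).differentiableAt (by simp))
    (fun i j => ((hF.contDiffAt_la hy j i).of_le (WithTop.coe_le_coe.2 le_top)).neg)
    ((hF.contDiffAt_sc hy).of_le (WithTop.coe_le_coe.2 le_top))
    (fun α i => (hF.contDiffAt_pr hy i α).differentiableAt (by simp))
    (fun j k l i γ δ => (hF.differentiableAt_bLa hy i γ δ j k l).neg) ?_ ?_ ?_ ?_
    (fun α j k i β γ => F.a_swap i β γ α j k y)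
    (fun j k l i γ δ => congrArg Neg.neg (F.bLa_swap i γ δ j k l y))
    ?_ ?_ hk hj i α γ β
  · rw [h]
    simp only [bLaD, neg_apply, neg_mul, ← neg_add, Finset.sum_neg_distrib]
    ring
  · filter_upwards [e.open_target.mem_nhds hy] with z hz i j
    rw [dOne_neg, hF.dOne_la hz]
    simp only [wedge₂_neg_left, wedge₂_neg_right, neg_neg, fun m γ => wedge₂_swap (F.cof γ i z) (F.pr m γ z), neg_smul,
      Finset.sum_neg_distrib, fun m => wedge₂_swap (F.la m i z) (F.la j m z)]
    rw [sum_pair_comm]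
    rw [kron_comm i j]
    module
  · intro i α
    rw [hF.dOne_cof hy]
    simp only [wedge₂_neg_left, wedge₂_neg_right, ← wedge₂_swap]
    abel
  · intro α i
    rw [hF.dOne_pr hy]
    simp only [wedge₂_neg_left, wedge₂_neg_right, ← wedge₂_swap]
    rw [sum_pair_comm fun k γ β j => F.a k α β γ i j y • wedge₂ (F.pr k γ y) (F.cof β j y)]
    abel
  · intro i α
    rw [sum_pair_comm]
    exact hF.eq_sum_wedge₂ hy (F.torsionForm_mem_skewForms α i y)
  · intro j k l i γ δ
    have hd : fderiv ℝ (fun z => -F.bLa i γ δ j k l z) y = -fderiv ℝ (F.bLa i γ δ j k l) y :=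
      fderiv_neg
    rw [hd, deltaBLa, Finset.sum_comm (γ := Fin q)]
    simp only [smul_neg, neg_smul, neg_neg, mul_neg, div_div, mul_comm (2 : ℝ) (p + q),
      kron_comm i k, kron_comm i l, kron_comm _ j]
    module
  · intro i α β j
    rw [hF.dual y hy, mul_comm]

end IsReduced

end MovingFrame

/-! ### The universal polynomials. -/

open MvPolynomial in
/-- The polynomial expressing `c^{αβγ}_{ijk}` in terms of `a`, `b^{βγδ}_{αkl}` and their Pfaffian
derivatives; `η` is any Greek index other than `β` and `γ`. -/
def polyGr {p q : ℕ} (η α β γ : Fin p) (i j k : Fin q) : MvPolynomial (VarGr p q) ℚ :=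
  C (-((p + q : ℚ) / (2 * (p * q)))) *
    (X (.bD α γ β η η k j i) - X (.bD α β γ η η j k i)
      + X (.bD α β η γ η j i k) - X (.bD α η β γ η i j k)
      + X (.bD α η γ β η i k j) - X (.bD α γ η β η k i j)
      + C 4 * ∑ ε, ∑ m, (X (.b α ε η η m i) * X (.a m γ β ε k j)
        + X (.b α ε γ η m k) * X (.a m β η ε j i)
        + X (.b α ε β η m j) * X (.a m η γ ε i k)))

open MvPolynomial in
/-- The polynomial expressing `c^{αβγ}_{ijk}` in terms of `a`, `b^{iγδ}_{jkl}` and their Pfaffian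
derivatives; `n` is any Latin index other than `j` and `k`. -/
def polyLa {p q : ℕ} (n : Fin q) (α β γ : Fin p) (i j k : Fin q) : MvPolynomial (VarLa p q) ℚ :=
  C ((p + q : ℚ) / (2 * (p * q))) *
    (X (.bD n γ β α i k j n) - X (.bD n β γ α i j k n)
      + X (.bD n β α γ i j n k) - X (.bD n α β γ i n j k)
      + X (.bD n α γ β i n k j) - X (.bD n γ α β i k n j)
      + C 4 * ∑ m, ∑ ε, (X (.b n ε α i m n) * X (.a m γ β ε k j)
        + X (.b n ε γ i m k) * X (.a m β α ε j n)
        + X (.b n ε β i m j) * X (.a m α γ ε n k)))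

namespace MovingFrame.IsReduced

variable {p q : ℕ} {F : MovingFrame p q} {M : Type*} [TopologicalSpace M]
  [ChartedSpace (Model p q) M] {S : AlmostGrassmannStructure p q M}
  {e : OpenPartialHomeomorph M (Model p q)} {y : Model p q}

theorem c_eq_aeval_polyGr (hF : F.IsReduced S e) (hy : y ∈ e.target) (hp : 0 < p) (hq : 0 < q)
    {η β γ : Fin p} (hβ : η ≠ β) (hγ : η ≠ γ) (α : Fin p) (i j k : Fin q) :
    F.c α β γ i j k y = MvPolynomial.aeval (F.valGr y) (polyGr η α β γ i j k) := by
  have h := hF.mul_c_eq_gr hy hβ hγ α i j k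
  have hp' : (0 : ℝ) < p := Nat.cast_pos.2 hp
  have hq' : (0 : ℝ) < q := Nat.cast_pos.2 hq
  -- The factor 2K is nonzero because p and q are positive; its inverse is, up to sign, the leading
  -- constant of `polyGr`.
  have hc : F.c α β γ i j k y = ((p + q : ℝ) / (2 * (p * q))) *
      ((p * q : ℝ) / (p + q) * (2 * F.c α β γ i j k y)) := by
    field_simp
  rw [hc, h]
  simp [polyGr, valGr]
  ring

theorem c_eq_aeval_polyLa (hF : F.IsReduced S e) (hy : y ∈ e.target) (hp : 0 < p) (hq : 0 < q)
    {n j k : Fin q} (hj : n ≠ j) (hk : n ≠ k) (α β γ : Fin p) (i : Fin q) :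
    F.c α β γ i j k y = MvPolynomial.aeval (F.valLa y) (polyLa n α β γ i j k) := by
  have h := hF.mul_c_eq_la hy hj hk α β γ i
  have hp' : (0 : ℝ) < p := Nat.cast_pos.2 hp
  have hq' : (0 : ℝ) < q := Nat.cast_pos.2 hq
  have hc : F.c α β γ i j k y = ((p + q : ℝ) / (2 * (p * q))) *
      ((p * q : ℝ) / (p + q) * (2 * F.c α β γ i j k y)) := by
    field_simp
  rw [hc, h]
  simp [polyLa, valLa]

end MovingFrame.IsReduced

theorem exists_ne_ne {n : ℕ} (hn : 2 < n) (a b : Fin n) : ∃ c, c ≠ a ∧ c ≠ b := by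
  obtain ⟨c, hc⟩ := Finset.exists_mem_notMem_of_card_lt_card
    (s := {a, b}) (t := (Finset.univ : Finset (Fin n)))
    (Finset.card_le_two.trans_lt (by simpa using hn))
  exact ⟨c, by simpa using hc⟩

end AlmostGrassmann

end

theorem theorem4p3 (p q : ℕ) (hp : 2 ≤ p) (hq : 2 ≤ q) :
    (2 < p →
      ∃ P : (α β γ : Fin p) → (i j k : Fin q) → MvPolynomial (AlmostGrassmann.VarGr p q) ℚ,
        ∀ (M : Type u) [TopologicalSpace M] [ChartedSpace (AlmostGrassmann.Model p q) M]
          [IsManifold 𝓘(ℝ, AlmostGrassmann.Model p q) ∞ M]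
          (S : AlmostGrassmann.AlmostGrassmannStructure p q M)
          (e : OpenPartialHomeomorph M (AlmostGrassmann.Model p q)),
          e ∈ IsManifold.maximalAtlas 𝓘(ℝ, AlmostGrassmann.Model p q) ∞ M →
          ∀ F : AlmostGrassmann.MovingFrame p q, F.IsReduced S e →
          ∀ y ∈ e.target, ∀ (α β γ : Fin p) (i j k : Fin q),
            F.c α β γ i j k y = MvPolynomial.aeval (F.valGr y) (P α β γ i j k)) ∧
    (2 < q →
      ∃ P : (α β γ : Fin p) → (i j k : Fin q) → MvPolynomial (AlmostGrassmann.VarLa p q) ℚ,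
        ∀ (M : Type u) [TopologicalSpace M] [ChartedSpace (AlmostGrassmann.Model p q) M]
          [IsManifold 𝓘(ℝ, AlmostGrassmann.Model p q) ∞ M]
          (S : AlmostGrassmann.AlmostGrassmannStructure p q M)
          (e : OpenPartialHomeomorph M (AlmostGrassmann.Model p q)),
          e ∈ IsManifold.maximalAtlas 𝓘(ℝ, AlmostGrassmann.Model p q) ∞ M →
          ∀ F : AlmostGrassmann.MovingFrame p q, F.IsReduced S e →
          ∀ y ∈ e.target, ∀ (α β γ : Fin p) (i j k : Fin q),
            F.c α β γ i j k y = MvPolynomial.aeval (F.valLa y) (P α β γ i j k)) := by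

  constructor
  · intro hp'
    -- The auxiliary index depends on β and γ alone, so the polynomials are fixed before the
    -- manifold and the frame are given.
    choose η hη using AlmostGrassmann.exists_ne_ne hp'
    refine ⟨fun α β γ => AlmostGrassmann.polyGr (η β γ) α β γ,
      fun M _ _ _ S e _ F hF y hy α β γ i j k => ?_⟩
    exact hF.c_eq_aeval_polyGr hy (by omega) (by omega) (hη β γ).1 (hη β γ).2 α i j k
  · intro hq'
    choose n hn using AlmostGrassmann.exists_ne_ne hq'
    refine ⟨fun α β γ i j k => AlmostGrassmann.polyLa (n j k) α β γ i j k,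
      fun M _ _ _ S e _ F hF y hy α β γ i j k => ?_⟩
    exact hF.c_eq_aeval_polyLa hy (by omega) (by omega) (hn j k).1 (hn j k).2 α β γ i
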